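/- Let $\alpha$ be an infinite set and let $G$ be the semigroup of finite transformations on $\alpha$, i.e. of maps $\tau:\alpha\to\alpha$ moving only finitely many points. A $GPHA_\alpha$ is an algebra $(A,\lor,\land,\to,0,\mathsf s_\tau,\mathsf c_{(J)},\mathsf q_{(J)})_{\tau\in G,\ J\subseteq\alpha\text{ finite}}$ such that $(A,\lor,\land,\to,0)$ is a Heyting algebra (with $1=0\to0$), each $\mathsf s_\tau$ is a Heyting endomorphism, each $\mathsf c_{(J)}$ is an existential quantifier ($\mathsf c0=0$, $p\le\mathsf cp$, $\mathsf c(p\land\mathsf cq)=\mathsf cp\land\mathsf cq$, $\mathsf c(\mathsf cp\to\mathsf cq)=\mathsf cp\to\mathsf cq$, $\mathsf c(\mathsf cp\lor\mathsf cq)=\mathsf cp\lor\mathsf cq$, $\mathsf c\mathsf cp=\mathsf cp$), each $\mathsf q_{(J)}$ is a universal quantifier ($\mathsf q1=1$, $\mathsf qp\le p$, $\mathsf q(p\to q)\le\mathsf qp\to\mathsf qq$, $\mathsf q\mathsf qp=\mathsf qp$), and for all $p\in A$, $\sigma,\tau\in G$ and finite $J,J'\subseteq\alpha$: $\mathsf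 s_{Id}p=p$; $\mathsf s_{\sigma\circ\tau}p=\mathsf s_\sigma\mathsf s_\tau p$; $\mathsf c_{(\emptyset)}p=\mathsf q_{(\emptyset)}p=p$; $\mathsf c_{(J\cup J')}p=\mathsf c_{(J)}\mathsf c_{(J')}p$ and $\mathsf q_{(J\cup J')}p=\mathsf q_{(J)}\mathsf q_{(J')}p$; $\mathsf c_{(J)}\mathsf q_{(J)}p=\mathsf q_{(J)}p$ and $\mathsf q_{(J)}\mathsf c_{(J)}p=\mathsf c_{(J)}p$; if $\sigma,\tau$ agree on $\alpha\setminus J$ then $\mathsf s_\sigma\mathsf c_{(J)}p=\mathsf s_\tau\mathsf c_{(J)}p$ and $\mathsf s_\sigma\mathsf q_{(J)}p=\mathsf s_\tau\mathsf q_{(J)}p$; if $\sigma$ is injective on $\sigma^{-1}(J)$ then $\mathsf c_{(J)}\mathsf s_\sigma p=\mathsf s_\sigma\mathsf c_{(\sigma^{-1}(J))}p$ and $\mathsf q_{(J)}\mathsf s_\sigma p=\mathsf s_\sigma\mathsf q_{(\sigma^{-1}(J))}p$. Write $\Delta x=\{i\in\alpha:\mathsf c_{(\{i\})}x\ne x\}$,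 and $\mathrm{Sg}\,Y$ for the subalgebra generated by $Y$. Let $\delta>0$ be a cardinal and $\rho:\delta\to\wp(\alpha)$ such that $\alpha\setminus\rho(i)$ is infinite for every $i\in\delta$. Let $A=\mathrm{Fr}^\rho_\delta GPHA_\alpha$ be the quotient of the absolutely free algebra on $\delta$ generators by the intersection of all congruences $R$ whose quotient is a $GPHA_\alpha$ and for which $\mathsf c_{(\{k\})}\eta\mathrel R\eta$ for every generator $\eta$ and every $k\in\alpha\setminus\rho(\eta)$; let $X$ be the set of its free generators. Assume that $\alpha\setminus\Delta a$ is infinite for every $a\in A$. Let $X=X_1\cup X_2$, let $\Delta_0,\Gamma_0\subseteq\mathrm{Sg}X_1$ and $\Theta_0,\Gamma_0^*\subseteq\mathrm{Sg}X_2$, and let $(\Delta_0,\Gamma_0)$ and $(\Theta_0,\Gamma_0^*)$ be consistent; here $(\Gamma,\Delta)$ is consistent if there are no $a_1,\dots,a_n\in\Gamma$, $b_1,\dots,b_m\in\Delta$ ($n,m\ge0$) with $a_1\land\dots\land a_n\le b_1\lor\dots\lor b_m$ (empty meet $1$, empty join $0$). Suppose that $\Gamma_0\subseteq\mathrm{Sg}(X_1\cap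 X_2)$, that $\Gamma_0\subseteq\Gamma_0^*$, and that $(\Delta_0\cap\Theta_0\cap\mathrm{Sg}X_1\cap\mathrm{Sg}X_2,\Gamma_0)$ is complete in $\mathrm{Sg}X_1\cap\mathrm{Sg}X_2$, i.e. every element of $\mathrm{Sg}X_1\cap\mathrm{Sg}X_2$ lies in $\Delta_0\cap\Theta_0$ or in $\Gamma_0$. A Kripke system of dimension $\alpha$ is $\mathfrak K=(K,\le,\{X_k\}_{k\in K},\{V_k\}_{k\in K})$ with $(K,\le)$ a preordered set, $X_k$ non-empty sets, $V_k\subseteq{}^\alpha X_k$ closed under $x\mapsto x\circ\tau$ for $\tau\in G$, and $X_k\subseteq X_{k'}$, $V_k\subseteq V_{k'}$ whenever $k\le k'$. Its set algebra $\mathfrak F_{\mathfrak K}$ consists of the families $(f_k)_{k\in K}$, $f_k:V_k\to\{0,1\}$, with $f_k\le f_{k'}$ on $V_k$ for $k\le k'$; $0,\lor,\land$ are pointwise; $((f)\to(g))_k(x)=1$ iff for all $k'\ge k$, $f_{k'}(x)=1$ implies $g_{k'}(x)=1$; $(\mathsf s_\tau f)_k(x)=f_k(x\circ\tau)$; $(\mathsf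 c_{(J)}f)_k(x)=1$ iff $f_k(y)=1$ for some $y\in V_k$ that agrees with $x$ off $J$; $(\mathsf q_{(J)}f)_k(x)=1$ iff $f_l(y)=1$ for all $l\ge k$ and all $y\in V_l$ that agree with $x$ off $J$. Then there exist a Kripke system $\mathfrak K$ of dimension $\alpha$, a homomorphism $\psi:A\to\mathfrak F_{\mathfrak K}$, a world $k_0\in K$ and $x\in V_{k_0}$ such that, writing $\psi(p)=(f_k)$, one has $f_{k_0}(x)=1$ for every $p\in\Delta_0\cup\Theta_0$ and $f_{k_0}(x)=0$ for every $p\in\Gamma_0^*$. -/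

import Mathlib

universe u v w

namespace PolyHeyting

/-- The semigroup `G` of finite transformations on `α`: maps that move only finitely many points. -/
def FinTrans (α : Type u) : Type u := {τ : α → α // {i | τ i ≠ i}.Finite}

namespace FinTrans

variable {α : Type u}

instance : CoeFun (FinTrans α) (fun _ => α → α) := ⟨Subtype.val⟩

/-- The identity transformation. -/
def one (α : Type u) : FinTrans α := ⟨fun i => i, by simp⟩

/-- Composition `σ ∘ τ`. -/
def comp (σ τ : FinTrans α) : FinTrans α :=
  ⟨fun i => σ (τ i), (σ.2.union τ.2).subset (by
    intro i hi
    by_cases h : τ i = i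
    · left
      simpa [h] using hi
    · right
      exact h)⟩

end FinTrans

/-- Algebras of the similarity type of polyadic Heyting algebras of dimension `α`: binary
operations `⊔`, `⊓`, `⇨`, a constant `⊥`, unary operations `s τ` for finite transformations `τ`,
and `c J`, `q J` for finite `J ⊆ α`.  No laws are imposed here. -/
class PolyOps (α : Type u) (A : Type v) extends Max A, Min A, HImp A, Bot A where
  /-- substitutions -/
  s : FinTrans α → A → A
  /-- cylindrifications (existential quantifiers) -/
  c : Finset α → A → A
  /-- universal quantifiers -/
  q : Finset α → A → A

open PolyOps

/-- The unit `1 = 0 → 0`. -/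
def one {A : Type v} [HImp A] [Bot A] : A := (⊥ : A) ⇨ ⊥

/-- The lattice order: `x ≤ y` iff `x ⊓ y = x`. -/
def le {A : Type v} [Min A] (x y : A) : Prop := x ⊓ y = x

/-- `(A, ⊔, ⊓, ⇨, ⊥)` is a Heyting algebra: a lattice with least element `⊥` in which `x ⇨ y` is
the pseudocomplement of `x` relative to `y`. -/
structure IsHeyting (A : Type v) [Max A] [Min A] [HImp A] [Bot A] : Prop where
  sup_comm : ∀ x y : A, x ⊔ y = y ⊔ x
  sup_assoc : ∀ x y z : A, x ⊔ y ⊔ z = x ⊔ (y ⊔ z)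
  inf_comm : ∀ x y : A, x ⊓ y = y ⊓ x
  inf_assoc : ∀ x y z : A, x ⊓ y ⊓ z = x ⊓ (y ⊓ z)
  sup_inf_self : ∀ x y : A, x ⊔ (x ⊓ y) = x
  inf_sup_self : ∀ x y : A, x ⊓ (x ⊔ y) = x
  bot_le : ∀ x : A, le ⊥ x
  le_himp_iff : ∀ x y z : A, le z (x ⇨ y) ↔ le (z ⊓ x) y

/-- `e` is an existential quantifier on the Heyting algebra `A`. -/
structure IsExistsQuantifier {A : Type v} [Max A] [Min A] [HImp A] [Bot A] (e : A → A) :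
    Prop where
  map_bot : e ⊥ = ⊥
  le_self : ∀ p, le p (e p)
  map_inf : ∀ p q, e (p ⊓ e q) = e p ⊓ e q
  map_himp : ∀ p q, e (e p ⇨ e q) = (e p ⇨ e q)
  map_sup : ∀ p q, e (e p ⊔ e q) = e p ⊔ e q
  idem : ∀ p, e (e p) = e p

/-- `a` is a universal quantifier on the Heyting algebra `A`. -/
structure IsForallQuantifier {A : Type v} [Max A] [Min A] [HImp A] [Bot A] (a : A → A) :
    Prop where
  map_one : a one = one
  self_le : ∀ p, le (a p) p
  map_himp : ∀ p q, le (a (p ⇨ q)) (a p ⇨ a q)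
  idem : ∀ p, a (a p) = a p

/-- The class `GPHA_α` of `α`-dimensional polyadic Heyting algebras, for `G` the semigroup of
finite transformations on `α`. In `c_s`, `q_s` the set `J'` is the preimage of `J` under `σ`. -/
structure IsGPHA (α : Type u) (A : Type v) [PolyOps α A] : Prop where
  heyting : IsHeyting A
  s_sup : ∀ (τ : FinTrans α) (x y : A), s τ (x ⊔ y) = s τ x ⊔ s τ y
  s_inf : ∀ (τ : FinTrans α) (x y : A), s τ (x ⊓ y) = s τ x ⊓ s τ y
  s_himp : ∀ (τ : FinTrans α) (x y : A), s τ (x ⇨ y) = (s τ x ⇨ s τ y)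
  s_bot : ∀ τ : FinTrans α, s τ (⊥ : A) = ⊥
  c_exists : ∀ J : Finset α, IsExistsQuantifier (c J : A → A)
  q_forall : ∀ J : Finset α, IsForallQuantifier (q J : A → A)
  s_one : ∀ p : A, s (FinTrans.one α) p = p
  s_comp : ∀ (σ τ : FinTrans α) (p : A), s (σ.comp τ) p = s σ (s τ p)
  c_empty : ∀ p : A, c (∅ : Finset α) p = p
  q_empty : ∀ p : A, q (∅ : Finset α) p = p
  c_union : ∀ (J J' J'' : Finset α) (p : A), (J'' : Set α) = ↑J ∪ ↑J' → c J'' p = c J (c J' p)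
  q_union : ∀ (J J' J'' : Finset α) (p : A), (J'' : Set α) = ↑J ∪ ↑J' → q J'' p = q J (q J' p)
  c_q : ∀ (J : Finset α) (p : A), c J (q J p) = q J p
  q_c : ∀ (J : Finset α) (p : A), q J (c J p) = c J p
  s_c : ∀ (σ τ : FinTrans α) (J : Finset α) (p : A), (∀ i, i ∉ J → σ i = τ i) →
    s σ (c J p) = s τ (c J p)
  s_q : ∀ (σ τ : FinTrans α) (J : Finset α) (p : A), (∀ i, i ∉ J → σ i = τ i) →
    s σ (q J p) = s τ (q J p)
  c_s : ∀ (σ : FinTrans α) (J J' : Finset α) (p : A), (J' : Set α) = σ ⁻¹' ↑J →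
    Set.InjOn σ (J' : Set α) → c J (s σ p) = s σ (c J' p)
  q_s : ∀ (σ : FinTrans α) (J J' : Finset α) (p : A), (J' : Set α) = σ ⁻¹' ↑J →
    Set.InjOn σ (J' : Set α) → q J (s σ p) = s σ (q J' p)

/-- The dimension set `Δ x = {i : c_i x ≠ x}`. -/
def dimSet (α : Type u) {A : Type v} [PolyOps α A] (x : A) : Set α := {i | c {i} x ≠ x}

/-- The universe `Sg X` of the subalgebra generated by `X`. -/
inductive Sg (α : Type u) {A : Type v} [PolyOps α A] (X : Set A) : Set A
  | base (x : A) : x ∈ X → Sg α X x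
  | bot : Sg α X ⊥
  | sup (x y : A) : Sg α X x → Sg α X y → Sg α X (x ⊔ y)
  | inf (x y : A) : Sg α X x → Sg α X y → Sg α X (x ⊓ y)
  | himp (x y : A) : Sg α X x → Sg α X y → Sg α X (x ⇨ y)
  | s (τ : FinTrans α) (x : A) : Sg α X x → Sg α X (s τ x)
  | c (J : Finset α) (x : A) : Sg α X x → Sg α X (c J x)
  | q (J : Finset α) (x : A) : Sg α X x → Sg α X (q J x)

/-- Homomorphisms of algebras of polyadic Heyting type. -/
structure PolyHom (α : Type u) (A : Type v) (B : Type w) [PolyOps α A] [PolyOps α B] where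
  toFun : A → B
  map_bot : toFun ⊥ = ⊥
  map_sup : ∀ x y, toFun (x ⊔ y) = toFun x ⊔ toFun y
  map_inf : ∀ x y, toFun (x ⊓ y) = toFun x ⊓ toFun y
  map_himp : ∀ x y, toFun (x ⇨ y) = (toFun x ⇨ toFun y)
  map_s : ∀ (τ : FinTrans α) x, toFun (s τ x) = s τ (toFun x)
  map_c : ∀ (J : Finset α) x, toFun (c J x) = c J (toFun x)
  map_q : ∀ (J : Finset α) x, toFun (q J x) = q J (toFun x)

/-! ### Theories -/

/-- Meet of finitely many elements; the empty meet is `1`. -/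
def listMeet {A : Type v} [Min A] [HImp A] [Bot A] (l : List A) : A := l.foldr (· ⊓ ·) one

/-- Join of finitely many elements; the empty join is `0`. -/
def listJoin {A : Type v} [Max A] [Bot A] (l : List A) : A := l.foldr (· ⊔ ·) ⊥

/-- `(Γ, Δ)` is a theory in the subalgebra with universe `S`. -/
def IsTheoryIn {A : Type v} (S Γ Δ : Set A) : Prop := Γ ⊆ S ∧ Δ ⊆ S

/-- `(Γ, Δ)` is consistent: there are no `a₁, …, aₙ ∈ Γ` and `b₁, …, bₘ ∈ Δ` (`n, m ≥ 0`) with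
`a₁ ∧ … ∧ aₙ ≤ b₁ ∨ … ∨ bₘ`. -/
def Consistent {A : Type v} [Max A] [Min A] [HImp A] [Bot A] (Γ Δ : Set A) : Prop :=
  ¬ ∃ l m : List A, (∀ a ∈ l, a ∈ Γ) ∧ (∀ b ∈ m, b ∈ Δ) ∧ le (listMeet l) (listJoin m)

/-- `(Γ, Δ)` is complete in the subalgebra with universe `S`. -/
def CompleteIn {A : Type v} (S Γ Δ : Set A) : Prop := ∀ a ∈ S, a ∈ Γ ∨ a ∈ Δ

/-! ### Dimension-restricted free algebras -/

/-- The absolutely free algebra of polyadic Heyting type with free generators indexed by `δ`. -/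
inductive Term (α : Type u) (δ : Type v) : Type (max u v)
  | gen (i : δ) : Term α δ
  | bot : Term α δ
  | sup (t t' : Term α δ) : Term α δ
  | inf (t t' : Term α δ) : Term α δ
  | himp (t t' : Term α δ) : Term α δ
  | s (τ : FinTrans α) (t : Term α δ) : Term α δ
  | c (J : Finset α) (t : Term α δ) : Term α δ
  | q (J : Finset α) (t : Term α δ) : Term α δ

instance (α : Type u) (δ : Type v) : PolyOps α (Term α δ) where
  max := Term.sup
  min := Term.inf
  himp := Term.himp
  bot := Term.bot
  s := Term.s
  c := Term.c
  q := Term.q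

/-- Congruence relations on an algebra of polyadic Heyting type. -/
structure PolyCon (α : Type u) (A : Type v) [PolyOps α A] extends Setoid A where
  sup : ∀ {x x' y y' : A}, r x x' → r y y' → r (x ⊔ y) (x' ⊔ y')
  inf : ∀ {x x' y y' : A}, r x x' → r y y' → r (x ⊓ y) (x' ⊓ y')
  himp : ∀ {x x' y y' : A}, r x x' → r y y' → r (x ⇨ y) (x' ⇨ y')
  s : ∀ (τ : FinTrans α) {x x' : A}, r x x' → r (PolyOps.s τ x) (PolyOps.s τ x')
  c : ∀ (J : Finset α) {x x' : A}, r x x' → r (PolyOps.c J x) (PolyOps.c J x')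
  q : ∀ (J : Finset α) {x x' : A}, r x x' → r (PolyOps.q J x) (PolyOps.q J x')

/-- The quotient algebra `A / R`. -/
def PolyCon.Quot {α : Type u} {A : Type v} [PolyOps α A] (R : PolyCon α A) : Type v :=
  Quotient R.toSetoid

instance {α : Type u} {A : Type v} [PolyOps α A] (R : PolyCon α A) : PolyOps α R.Quot where
  max := Quotient.map₂ (· ⊔ ·) fun _ _ h _ _ h' => R.sup h h'
  min := Quotient.map₂ (· ⊓ ·) fun _ _ h _ _ h' => R.inf h h'
  himp := Quotient.map₂ (· ⇨ ·) fun _ _ h _ _ h' => R.himp h h'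
  bot := Quotient.mk _ ⊥
  s τ := Quotient.map (PolyOps.s τ) fun _ _ h => R.s τ h
  c J := Quotient.map (PolyOps.c J) fun _ _ h => R.c J h
  q J := Quotient.map (PolyOps.q J) fun _ _ h => R.q J h

/-- The congruences `R` of the absolutely free algebra over which `Cr^ρ` is the intersection: the
quotient lies in `GPHA_α` (a class closed under subalgebras and products), and
`c_k η / R = η / R` for every generator `η` and every `k ∉ ρ η`. -/
def Admissible {α : Type u} {δ : Type v} (ρ : δ → Set α) (R : PolyCon α (Term α δ)) : Prop :=
  IsGPHA α R.Quot ∧ ∀ (i : δ) (k : α), k ∉ ρ i → R.r (c {k} (Term.gen i)) (Term.gen i)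

/-- The congruence `Cr^ρ`, the intersection of all admissible congruences. -/
def Cr {α : Type u} {δ : Type v} (ρ : δ → Set α) : PolyCon α (Term α δ) where
  r t t' := ∀ R : PolyCon α (Term α δ), Admissible ρ R → R.r t t'
  iseqv :=
    { refl := fun t R _ => R.iseqv.refl t
      symm := fun h R hR => R.iseqv.symm (h R hR)
      trans := fun h h' R hR => R.iseqv.trans (h R hR) (h' R hR) }
  sup h h' R hR := R.sup (h R hR) (h' R hR)
  inf h h' R hR := R.inf (h R hR) (h' R hR)
  himp h h' R hR := R.himp (h R hR) (h' R hR)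
  s τ _ _ h R hR := R.s τ (h R hR)
  c J _ _ h R hR := R.c J (h R hR)
  q J _ _ h R hR := R.q J (h R hR)

/-- The free algebra `Fr_δ^ρ GPHA_α` dimension-restricted by `ρ`. -/
abbrev Fr {α : Type u} {δ : Type v} (ρ : δ → Set α) : Type (max u v) := (Cr ρ).Quot

/-- The free generators of `Fr_δ^ρ GPHA_α`. -/
def Fr.gen {α : Type u} {δ : Type v} (ρ : δ → Set α) (i : δ) : Fr ρ :=
  Quotient.mk _ (Term.gen i)

/-! ### Kripke systems and their set algebras -/

/-- Kripke systems of dimension `α`. The sets `X_k` are subsets of one ambient type. The last field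
says that `x ∘ τ ∈ V_k` for `x ∈ V_k` and `τ ∈ G`; the definition of `s_τ` in the set algebra
needs it. -/
structure KripkeSystem (α : Type u) where
  K : Type w
  [pre : Preorder K]
  Point : Type w
  X : K → Set Point
  V : K → Set (α → Point)
  X_nonempty : ∀ k, (X k).Nonempty
  V_subset : ∀ k, ∀ x ∈ V k, ∀ i, x i ∈ X k
  X_mono : ∀ {k k' : K}, k ≤ k' → X k ⊆ X k'
  V_mono : ∀ {k k' : K}, k ≤ k' → V k ⊆ V k'
  comp_mem : ∀ k, ∀ x ∈ V k, ∀ τ : FinTrans α, (fun i => x (τ i)) ∈ V k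

attribute [instance] KripkeSystem.pre

/-- The universe of the set algebra of a Kripke system: families `(f_k : V_k → {0,1})` with
`f_k ≤ f_k'` for `k ≤ k'`. The two-element algebra `{0,1}` is `Prop`; `f_k(x) = 1` is `val k x`. -/
@[ext]
structure SetAlg {α : Type u} (S : KripkeSystem.{u, w} α) where
  val : ∀ k, S.V k → Prop
  mono : ∀ {k k' : S.K} (h : k ≤ k') (x : S.V k), val k x → val k' ⟨x, S.V_mono h x.2⟩

/-- `x` and `y` agree outside `J`. -/
def EqOff {α : Type u} {P : Type w} (J : Finset α) (x y : α → P) : Prop := ∀ i, i ∉ J → x i = y i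

instance {α : Type u} (S : KripkeSystem.{u, w} α) : PolyOps α (SetAlg S) where
  bot := ⟨fun _ _ => False, fun _ _ h => h⟩
  max f g := ⟨fun k x => f.val k x ∨ g.val k x, fun h x => Or.imp (f.mono h x) (g.mono h x)⟩
  min f g := ⟨fun k x => f.val k x ∧ g.val k x, fun h x => And.imp (f.mono h x) (g.mono h x)⟩
  himp f g :=
    ⟨fun k x => ∀ (k' : S.K) (h : k ≤ k'),
        f.val k' ⟨x, S.V_mono h x.2⟩ → g.val k' ⟨x, S.V_mono h x.2⟩,
      fun h _ H k'' h' => H k'' (h.trans h')⟩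
  s τ f :=
    ⟨fun k x => f.val k ⟨fun i => x.1 (τ i), S.comp_mem k x.1 x.2 τ⟩, fun h _ => f.mono h _⟩
  c J f :=
    ⟨fun k x => ∃ y : S.V k, EqOff J y.1 x.1 ∧ f.val k y,
      fun h _ ⟨y, hy, H⟩ => ⟨⟨y.1, S.V_mono h y.2⟩, hy, f.mono h y H⟩⟩
  q J f :=
    ⟨fun k x => ∀ l : S.K, k ≤ l → ∀ y : S.V l, EqOff J y.1 x.1 → f.val l y,
      fun h _ H l hl y hy => H l (h.trans hl) y hy⟩

end PolyHeyting

/-! This is a Henkin construction carried out in two languages at once. A world consists of a theory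
in the language of `X₁` and a theory in that of `X₂`, both with parameters. Each is prime,
deductively closed and witnessed, and they agree on the common language. Ordering worlds by level
and inclusion gives one Kripke system in which a generator holds if either theory contains the
corresponding instance. Agreement makes this unambiguous, freeness of `Fr ρ` extends it to a
homomorphism, and `truth_lemma`, applied to each side separately, identifies truth of elements of
`Sg X₁` and `Sg X₂` with membership.

Quantifiers need fresh variables. An element depends only on finitely many generators and finitely
many other indices (`exists_support`), and the meet of those generators depends on every index that
any of them may use (`dimSet_inf_gen`). So the assumption on dimension sets gives infinitely many
indices fresh for any finite set of elements. For fresh `w`, `s_σ q_z b` equals `q_w` applied to the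
instance `s_{σ[z ↦ w]} b` (`exists_pullback`), so quantifiers become meets and joins of instances.
Instead of an algebra of larger dimension, an element with parameters from `Q` is a function from `Q
→ α` to `Fr ρ`. Not mentioning a parameter then means not depending on a coordinate, and quantifying
over a parameter is described purely by the order. Hence the closures computed in `Sg X₁` and in `Sg
X₂` coincide and the common language is closed under them (`common_forall_param`,
`common_exists_param`).

The invariant is inseparability (`Insep`): no common `θ` follows from the second theory while `θ ⇨
y` follows from the first for some `y` to be omitted. Closing a separator universally or
existentially over a new parameter shows that witnesses may be added. A maximal inseparable pair is
prime, closed and in agreement (`exists_saturated`). Alternating witnesses and maximality `ω` times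
gives a world (`exists_world`). Refuted implications and universal statements are handled in
extended worlds with further parameters.

The initial pair is inseparable because a parameter-free common separator lies, by completeness,
either in `Δ₀ ∩ Θ₀`, against the consistency of `(Θ₀, Γ₀')`, or in `Γ₀`, against that of `(Δ₀, Γ₀)`.
-/

namespace PolyHeyting

open PolyOps

/-! ### Order-theoretic consequences of the Heyting axioms -/

namespace IsHeyting

variable {A : Type v} [Max A] [Min A] [HImp A] [Bot A]

theorem inf_idem (h : IsHeyting A) (x : A) : x ⊓ x = x := by
  have := h.inf_sup_self x (x ⊓ x)
  rwa [h.sup_inf_self] at this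

theorem le_iff_sup (h : IsHeyting A) (x y : A) : le x y ↔ x ⊔ y = y := by
  constructor
  · intro hxy
    rw [← (hxy : x ⊓ y = x), h.sup_comm, h.inf_comm, h.sup_inf_self]
  · intro hxy
    rw [le, ← hxy, h.inf_sup_self]

/-- The Heyting algebra in the sense of Mathlib given by operations satisfying `IsHeyting`. -/
abbrev toHeytingAlgebra (h : IsHeyting A) : HeytingAlgebra A where
  sup x y := x ⊔ y
  inf x y := x ⊓ y
  himp x y := x ⇨ y
  bot := ⊥
  top := one
  compl x := x ⇨ ⊥
  le x y := le x y
  le_refl x := h.inf_idem x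
  le_trans x y z hxy hyz := by
    change x ⊓ z = x
    rw [← (hxy : x ⊓ y = x), h.inf_assoc, (hyz : y ⊓ z = y)]
  le_antisymm x y hxy hyx := by
    rw [← (hxy : x ⊓ y = x), h.inf_comm, (hyx : y ⊓ x = y)]
  le_sup_left x y := h.inf_sup_self x y
  le_sup_right x y := by
    rw [h.sup_comm]; exact h.inf_sup_self y x
  sup_le x y z hxz hyz := by
    rw [h.le_iff_sup] at *
    rw [h.sup_assoc, hyz, hxz]
  inf_le_left x y := by
    change x ⊓ y ⊓ x = x ⊓ y
    rw [h.inf_comm, ← h.inf_assoc, h.inf_idem]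
  inf_le_right x y := by
    change x ⊓ y ⊓ y = x ⊓ y
    rw [h.inf_assoc, h.inf_idem]
  le_inf x y z hxy hxz := by
    change x ⊓ (y ⊓ z) = x
    rw [← h.inf_assoc, (hxy : x ⊓ y = x), (hxz : x ⊓ z = x)]
  le_top x := by
    refine (h.le_himp_iff _ _ _).2 ?_
    change x ⊓ ⊥ ⊓ ⊥ = x ⊓ ⊥
    rw [h.inf_assoc, h.inf_idem]
  bot_le x := h.bot_le x
  le_himp_iff x y z := h.le_himp_iff y z x
  himp_bot _ := rfl

end IsHeyting

/-! ### Homomorphisms -/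

namespace PolyHom

variable {α : Type u} {A : Type v} {B : Type w} [PolyOps α A] [PolyOps α B]

theorem map_one (φ : PolyHom α A B) : φ.toFun one = one := by
  simp only [one, φ.map_himp, φ.map_bot]

theorem le_map (φ : PolyHom α A B) {x y : A} (h : le x y) : le (φ.toFun x) (φ.toFun y) := by
  rw [le, ← φ.map_inf, h]

end PolyHom

/-- An algebra with a jointly injective family of homomorphisms into members of `GPHA_α` lies in
`GPHA_α`. -/
theorem isGPHA_of_jointlyInjective {α : Type u} {A : Type v} [PolyOps α A] {ι : Type*}
    (B : ι → Type*) [∀ i, PolyOps α (B i)] (φ : ∀ i, PolyHom α A (B i))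
    (hB : ∀ i, IsGPHA α (B i))
    (hφ : ∀ x y : A, (∀ i, (φ i).toFun x = (φ i).toFun y) → x = y) : IsGPHA α A := by
  -- The order is defined by an equation, so homomorphisms preserve it and the joint family reflects
  -- it; this also handles the equivalence `le_himp_iff`.
  have hle : ∀ x y : A, (∀ i, le ((φ i).toFun x) ((φ i).toFun y)) → le x y := by
    intro x y h
    refine hφ _ _ fun i => ?_
    rw [(φ i).map_inf]
    exact h i
  have simps := fun i => And.intro (φ i).map_sup <| And.intro (φ i).map_inf <|
    And.intro (φ i).map_himp <| And.intro (φ i).map_s <| And.intro (φ i).map_c <|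
    And.intro (φ i).map_q <| And.intro (φ i).map_bot (φ i).map_one
  refine
    { heyting := ?_, c_exists := fun J => ?_, q_forall := fun J => ?_
      s_sup := fun τ x y => hφ _ _ fun i => ?_
      s_inf := fun τ x y => hφ _ _ fun i => ?_
      s_himp := fun τ x y => hφ _ _ fun i => ?_
      s_bot := fun τ => hφ _ _ fun i => ?_
      s_one := fun p => hφ _ _ fun i => ?_
      s_comp := fun σ τ p => hφ _ _ fun i => ?_
      c_empty := fun p => hφ _ _ fun i => ?_
      q_empty := fun p => hφ _ _ fun i => ?_
      c_union := fun J J' J'' p h => hφ _ _ fun i => ?_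
      q_union := fun J J' J'' p h => hφ _ _ fun i => ?_
      c_q := fun J p => hφ _ _ fun i => ?_
      q_c := fun J p => hφ _ _ fun i => ?_
      s_c := fun σ τ J p h => hφ _ _ fun i => ?_
      s_q := fun σ τ J p h => hφ _ _ fun i => ?_
      c_s := fun σ J J' p h h' => hφ _ _ fun i => ?_
      q_s := fun σ J J' p h h' => hφ _ _ fun i => ?_ }
  · refine
      { sup_comm := fun x y => hφ _ _ fun i => ?_
        sup_assoc := fun x y z => hφ _ _ fun i => ?_
        inf_comm := fun x y => hφ _ _ fun i => ?_
        inf_assoc := fun x y z => hφ _ _ fun i => ?_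
        sup_inf_self := fun x y => hφ _ _ fun i => ?_
        inf_sup_self := fun x y => hφ _ _ fun i => ?_
        bot_le := fun x => hle _ _ fun i => ?_
        le_himp_iff := fun x y z =>
          ⟨fun h => hle _ _ fun i => ?_, fun h => hle _ _ fun i => ?_⟩ }
    all_goals simp only [simps]
    · exact (hB i).heyting.sup_comm _ _
    · exact (hB i).heyting.sup_assoc _ _ _
    · exact (hB i).heyting.inf_comm _ _
    · exact (hB i).heyting.inf_assoc _ _ _
    · exact (hB i).heyting.sup_inf_self _ _
    · exact (hB i).heyting.inf_sup_self _ _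
    · exact (hB i).heyting.bot_le _
    · rw [← (hB i).heyting.le_himp_iff, ← (φ i).map_himp]
      exact (φ i).le_map h
    · rw [(hB i).heyting.le_himp_iff, ← (φ i).map_inf]
      exact (φ i).le_map h
  all_goals first | simp only [simps] | skip
  · exact (hB i).s_sup _ _ _
  · exact (hB i).s_inf _ _ _
  · exact (hB i).s_himp _ _ _
  · exact (hB i).s_bot _
  · refine
      { map_bot := hφ _ _ fun i => ?_
        le_self := fun p => hle _ _ fun i => ?_
        map_inf := fun p q => hφ _ _ fun i => ?_
        map_himp := fun p q => hφ _ _ fun i => ?_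
        map_sup := fun p q => hφ _ _ fun i => ?_
        idem := fun p => hφ _ _ fun i => ?_ }
    all_goals simp only [simps]
    · exact ((hB i).c_exists J).map_bot
    · exact ((hB i).c_exists J).le_self _
    · exact ((hB i).c_exists J).map_inf _ _
    · exact ((hB i).c_exists J).map_himp _ _
    · exact ((hB i).c_exists J).map_sup _ _
    · exact ((hB i).c_exists J).idem _
  · refine
      { map_one := hφ _ _ fun i => ?_
        self_le := fun p => hle _ _ fun i => ?_
        map_himp := fun p q => hle _ _ fun i => ?_
        idem := fun p => hφ _ _ fun i => ?_ }
    all_goals simp only [simps]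
    · exact ((hB i).q_forall J).map_one
    · exact ((hB i).q_forall J).self_le _
    · exact ((hB i).q_forall J).map_himp _ _
    · exact ((hB i).q_forall J).idem _
  · exact (hB i).s_one _
  · exact (hB i).s_comp _ _ _
  · exact (hB i).c_empty _
  · exact (hB i).q_empty _
  · exact (hB i).c_union _ _ _ _ h
  · exact (hB i).q_union _ _ _ _ h
  · exact (hB i).c_q _ _
  · exact (hB i).q_c _ _
  · exact (hB i).s_c _ _ _ _ h
  · exact (hB i).s_q _ _ _ _ h
  · exact (hB i).c_s _ _ _ _ h h'
  · exact (hB i).q_s _ _ _ _ h h'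

/-! ### Freeness of the dimension-restricted free algebra -/

section Free

variable {α : Type u} {δ : Type v}

/-- The value of a term under an assignment of the generators. -/
def Term.eval {C : Type w} [PolyOps α C] (g : δ → C) : Term α δ → C
  | .gen i => g i
  | .bot => ⊥
  | .sup t t' => t.eval g ⊔ t'.eval g
  | .inf t t' => t.eval g ⊓ t'.eval g
  | .himp t t' => t.eval g ⇨ t'.eval g
  | .s τ t => PolyOps.s τ (t.eval g)
  | .c J t => PolyOps.c J (t.eval g)
  | .q J t => PolyOps.q J (t.eval g)

/-- The kernel of the evaluation of terms. -/
def evalKer {C : Type w} [PolyOps α C] (g : δ → C) : PolyCon α (Term α δ) where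
  r t t' := t.eval g = t'.eval g
  iseqv := ⟨fun _ => rfl, fun h => h.symm, fun h h' => h.trans h'⟩
  sup h h' := congr_arg₂ (· ⊔ ·) h h'
  inf h h' := congr_arg₂ (· ⊓ ·) h h'
  himp h h' := congr_arg₂ (· ⇨ ·) h h'
  s τ _ _ h := congr_arg (PolyOps.s τ) h
  c J _ _ h := congr_arg (PolyOps.c J) h
  q J _ _ h := congr_arg (PolyOps.q J) h

/-- A homomorphism of terms that respects a congruence factors through the quotient. -/
def evalLift {C : Type w} [PolyOps α C] (g : δ → C) (R : PolyCon α (Term α δ))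
    (h : ∀ t t', R.r t t' → t.eval g = t'.eval g) : PolyHom α R.Quot C where
  toFun := Quotient.lift (Term.eval g) h
  map_bot := rfl
  map_sup := by rintro ⟨x⟩ ⟨y⟩; rfl
  map_inf := by rintro ⟨x⟩ ⟨y⟩; rfl
  map_himp := by rintro ⟨x⟩ ⟨y⟩; rfl
  map_s := by rintro τ ⟨x⟩; rfl
  map_c := by rintro τ ⟨x⟩; rfl
  map_q := by rintro τ ⟨x⟩; rfl

/-- The quotient by the kernel embeds in `C`, and the class is closed under subalgebras. -/
theorem admissible_evalKer {C : Type w} [PolyOps α C] (hC : IsGPHA α C) (ρ : δ → Set α)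
    (g : δ → C) (hg : ∀ i k, k ∉ ρ i → c {k} (g i) = g i) : Admissible ρ (evalKer (α := α) g) := by
  refine ⟨isGPHA_of_jointlyInjective (fun _ : Unit => C)
    (fun _ => evalLift g (evalKer g) fun _ _ h => h) (fun _ => hC) ?_, fun i k hk => hg i k hk⟩
  rintro ⟨x⟩ ⟨y⟩ h
  exact Quotient.sound (h ())

/-- The homomorphism from the dimension-restricted free algebra extending an assignment. -/
def Fr.lift {C : Type w} [PolyOps α C] (hC : IsGPHA α C) (ρ : δ → Set α)
    (g : δ → C) (hg : ∀ i k, k ∉ ρ i → c {k} (g i) = g i) : PolyHom α (Fr ρ) C :=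
  evalLift g (Cr ρ) fun _ _ h => h _ (admissible_evalKer hC ρ g hg)

/-- The projection of the free algebra onto the quotient by an admissible congruence. -/
def Fr.proj (ρ : δ → Set α) (R : PolyCon α (Term α δ)) (hR : Admissible ρ R) :
    PolyHom α (Fr ρ) R.Quot where
  toFun := Quotient.map id fun _ _ h => h R hR
  map_bot := rfl
  map_sup := by rintro ⟨x⟩ ⟨y⟩; rfl
  map_inf := by rintro ⟨x⟩ ⟨y⟩; rfl
  map_himp := by rintro ⟨x⟩ ⟨y⟩; rfl
  map_s := by rintro τ ⟨x⟩; rfl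
  map_c := by rintro τ ⟨x⟩; rfl
  map_q := by rintro τ ⟨x⟩; rfl

/-- `Cr ρ` is the intersection of the admissible congruences, so the projections to their quotients
are jointly injective. -/
theorem Fr.isGPHA (ρ : δ → Set α) : IsGPHA α (Fr ρ) := by
  refine isGPHA_of_jointlyInjective (fun R : {R // Admissible ρ R} => R.1.Quot)
    (fun R => Fr.proj ρ R.1 R.2) (fun R => R.2.1) ?_
  rintro ⟨x⟩ ⟨y⟩ h
  exact Quotient.sound fun R hR => Quotient.exact (h ⟨R, hR⟩)

theorem Fr.c_gen (ρ : δ → Set α) {i : δ} {k : α} (hk : k ∉ ρ i) :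
    c {k} (Fr.gen ρ i) = Fr.gen ρ i :=
  Quotient.sound fun _ hR => hR.2 i k hk

theorem Fr.mem_Sg (ρ : δ → Set α) (a : Fr ρ) : a ∈ Sg α (Set.range (Fr.gen ρ)) := by
  rcases a with ⟨t⟩
  induction t with
  | gen i => exact Sg.base _ ⟨i, rfl⟩
  | bot => exact Sg.bot
  | sup t t' h h' => exact Sg.sup _ _ h h'
  | inf t t' h h' => exact Sg.inf _ _ h h'
  | himp t t' h h' => exact Sg.himp _ _ h h'
  | s τ t h => exact Sg.s τ _ h
  | c J t h => exact Sg.c J _ h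
  | q J t h => exact Sg.q J _ h

instance (ρ : δ → Set α) : HeytingAlgebra (Fr ρ) := (Fr.isGPHA ρ).heyting.toHeytingAlgebra

end Free

/-! ### Weak Kripke systems -/

section Weak

variable {α : Type u} {K : Type w} [Preorder K] {P : Type w}

theorem finite_ne_comp {base x : α → P} (hx : {i | x i ≠ base i}.Finite) (τ : FinTrans α) :
    {i | x (τ i) ≠ base i}.Finite := by
  refine (hx.union τ.2).subset fun i hi => ?_
  by_cases h : τ i = i
  · left; simpa [h] using hi
  · right; exact h

/-- The Kripke system with increasing domains `D k` whose assignments at `k` are the finite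
modifications of a fixed sequence `base` with values in `D k`. -/
abbrev weakSystem [Nonempty α] (base : α → P) (D : K → Set P) (hD : Monotone D)
    (hbase : ∀ k i, base i ∈ D k) : KripkeSystem.{u, w} α where
  K := K
  Point := P
  X := D
  V k := {x | (∀ i, x i ∈ D k) ∧ {i | x i ≠ base i}.Finite}
  X_nonempty k := ⟨base (Classical.arbitrary α), hbase k _⟩
  V_subset _ _ hx := hx.1
  X_mono h := hD h
  V_mono h _ hx := ⟨fun i => hD h (hx.1 i), hx.2⟩
  comp_mem _ _ hx τ := ⟨fun i => hx.1 (τ i), finite_ne_comp hx.2 τ⟩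

theorem SetAlg.le_iff {S : KripkeSystem.{u, w} α} {f g : SetAlg S} :
    le f g ↔ ∀ k x, f.val k x → g.val k x := by
  constructor
  · intro h k x hx
    have : (f ⊓ g).val k x := by rw [(h : f ⊓ g = f)]; exact hx
    exact this.2
  · intro h
    refine SetAlg.ext (funext fun k => funext fun x => propext ?_)
    exact ⟨fun hx => hx.1, fun hx => ⟨hx, h k x hx⟩⟩

theorem SetAlg.ext_val {S : KripkeSystem.{u, w} α} {f g : SetAlg S}
    (h : ∀ k x, f.val k x ↔ g.val k x) : f = g :=
  SetAlg.ext (funext fun k => funext fun x => propext (h k x))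

theorem SetAlg.isHeyting (S : KripkeSystem.{u, w} α) : IsHeyting (SetAlg S) where
  sup_comm _ _ := SetAlg.ext_val fun _ _ => or_comm
  sup_assoc _ _ _ := SetAlg.ext_val fun _ _ => or_assoc
  inf_comm _ _ := SetAlg.ext_val fun _ _ => and_comm
  inf_assoc _ _ _ := SetAlg.ext_val fun _ _ => and_assoc
  sup_inf_self _ _ := SetAlg.ext_val fun _ _ => or_iff_left_of_imp And.left
  inf_sup_self _ _ := SetAlg.ext_val fun _ _ => and_iff_left_of_imp Or.inl
  bot_le _ := SetAlg.le_iff.2 fun _ _ h => False.elim h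
  le_himp_iff f g e := by
    simp only [SetAlg.le_iff]
    constructor
    · intro h k x hx
      exact h k x hx.1 k le_rfl hx.2
    · intro h k x hx k' hk hf
      exact h k' _ ⟨e.mono hk x hx, hf⟩

theorem EqOff.symm {J : Finset α} {x y : α → P} (h : EqOff J x y) : EqOff J y x :=
  fun i hi => (h i hi).symm

theorem EqOff.trans {J : Finset α} {x y z : α → P} (h : EqOff J x y) (h' : EqOff J y z) :
    EqOff J x z := fun i hi => (h i hi).trans (h' i hi)

theorem SetAlg.c_exists (S : KripkeSystem.{u, w} α) (J : Finset α) :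
    IsExistsQuantifier (c J : SetAlg S → SetAlg S) where
  map_bot := SetAlg.ext_val fun _ _ => ⟨fun ⟨_, _, h⟩ => h, False.elim⟩
  le_self p := SetAlg.le_iff.2 fun k x h => ⟨x, fun _ _ => rfl, h⟩
  map_inf p q := SetAlg.ext_val fun k x =>
    ⟨fun ⟨y, hy, hp, z, hz, hq⟩ => ⟨⟨y, hy, hp⟩, z, hz.trans hy, hq⟩,
      fun ⟨⟨y, hy, hp⟩, z, hz, hq⟩ => ⟨y, hy, hp, z, hz.trans hy.symm, hq⟩⟩
  map_himp p q := SetAlg.ext_val fun k x => by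
    constructor
    · rintro ⟨y, hy, h⟩ k' hk ⟨z, hz, hp⟩
      obtain ⟨t, ht, hq⟩ := h k' hk ⟨z, hz.trans hy.symm, hp⟩
      exact ⟨t, ht.trans hy, hq⟩
    · intro h
      exact ⟨x, fun _ _ => rfl, h⟩
  map_sup p q := SetAlg.ext_val fun k x => by
    constructor
    · rintro ⟨y, hy, ⟨z, hz, h⟩ | ⟨z, hz, h⟩⟩
      · exact Or.inl ⟨z, hz.trans hy, h⟩
      · exact Or.inr ⟨z, hz.trans hy, h⟩
    · intro h
      exact ⟨x, fun _ _ => rfl, h⟩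
  idem p := SetAlg.ext_val fun k x =>
    ⟨fun ⟨y, hy, z, hz, h⟩ => ⟨z, hz.trans hy, h⟩, fun h => ⟨x, fun _ _ => rfl, h⟩⟩

theorem SetAlg.q_forall (S : KripkeSystem.{u, w} α) (J : Finset α) :
    IsForallQuantifier (q J : SetAlg S → SetAlg S) where
  map_one := SetAlg.ext_val fun _ _ =>
    ⟨fun _ _ _ h => h, fun _ _ _ _ _ _ _ h => h⟩
  self_le _ := SetAlg.le_iff.2 fun k x h => h k le_rfl x fun _ _ => rfl
  map_himp _ _ := SetAlg.le_iff.2 fun _ _ h _ hk hp l hl y hy =>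
    h l (hk.trans hl) y hy l le_rfl (hp l hl y hy)
  idem _ := SetAlg.ext_val fun _ _ =>
    ⟨fun h l hl y hy => h l hl y hy l le_rfl y fun _ _ => rfl,
      fun h _ hl _ hy l' hl' y' hy' => h l' (hl.trans hl') y' (hy'.trans hy)⟩

/-- Finite modifications of `x` in a weak Kripke system. -/
theorem weak_modify {base x y : α → P} (hx : {i | x i ≠ base i}.Finite) (J : Finset α)
    (h : EqOff J y x) : {i | y i ≠ base i}.Finite := by
  refine (hx.union J.finite_toSet).subset fun i hi => ?_
  by_cases hJ : i ∈ J
  · right; exact hJ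
  · left; simpa [h i hJ] using hi

open Classical in
/-- Given `z` agreeing with `x ∘ σ` off `σ⁻¹ J`, with `σ` injective on `σ⁻¹ J`, there is `y` agreeing
with `x` off `J` such that `y ∘ σ = z`. -/
theorem exists_extend {x z : α → P} {σ : α → α} {J J' : Finset α}
    (hJ : (J' : Set α) = σ ⁻¹' ↑J) (hinj : Set.InjOn σ (J' : Set α))
    (h : EqOff J' z fun i => x (σ i)) :
    ∃ y, EqOff J y x ∧ (fun i => y (σ i)) = z ∧ ∀ j, (∃ i, y j = z i) ∨ y j = x j := by
  have hmem : ∀ i, i ∈ J' ↔ σ i ∈ J := fun i => by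
    rw [← Finset.mem_coe, hJ]; simp
  -- Injectivity of `σ` on `J'` makes the chosen preimage the only one. The last conjunct of the
  -- goal keeps the values of `y` inside the domain of a world.
  refine ⟨fun j => if hj : ∃ i, i ∈ J' ∧ σ i = j then z hj.choose else x j, ?_, ?_, ?_⟩
  · intro j hj
    have : ¬ ∃ i, i ∈ J' ∧ σ i = j := by
      rintro ⟨i, hi, rfl⟩
      exact hj ((hmem i).1 hi)
    simp only [dif_neg this]
  · funext i
    by_cases hi : i ∈ J'
    · have hex : ∃ i', i' ∈ J' ∧ σ i' = σ i := ⟨i, hi, rfl⟩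
      simp only [dif_pos hex]
      rw [hinj hex.choose_spec.1 hi hex.choose_spec.2]
    · have hex : ¬ ∃ i', i' ∈ J' ∧ σ i' = σ i := by
        rintro ⟨i', hi', he⟩
        exact hi ((hmem i).2 (he ▸ (hmem i').1 hi'))
      simp only [dif_neg hex]
      exact (h i hi).symm
  · intro j
    by_cases hj : ∃ i, i ∈ J' ∧ σ i = j
    · left; exact ⟨hj.choose, by simp only [dif_pos hj]⟩
    · right; simp only [dif_neg hj]

open Classical in
/-- The set algebra of a weak Kripke system lies in `GPHA_α`. -/
theorem isGPHA_weakSystem [Nonempty α] (base : α → P) (D : K → Set P) (hD : Monotone D)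
    (hbase : ∀ k i, base i ∈ D k) : IsGPHA α (SetAlg (weakSystem base D hD hbase)) where
  heyting := SetAlg.isHeyting _
  s_sup _ _ _ := rfl
  s_inf _ _ _ := rfl
  s_himp _ _ _ := rfl
  s_bot _ := rfl
  c_exists := SetAlg.c_exists _
  q_forall := SetAlg.q_forall _
  s_one _ := rfl
  s_comp _ _ _ := rfl
  c_empty p := SetAlg.ext_val fun k x => by
    constructor
    · rintro ⟨y, hy, h⟩
      have : y = x := Subtype.ext (funext fun i => hy i (by simp))
      exact this ▸ h
    · intro h
      exact ⟨x, fun _ _ => rfl, h⟩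
  q_empty p := SetAlg.ext_val fun k x => by
    constructor
    · intro h
      exact h k le_rfl x fun _ _ => rfl
    · intro h l hl y hy
      have : y = ⟨x.1, KripkeSystem.V_mono _ hl x.2⟩ :=
        Subtype.ext (funext fun i => hy i (by simp))
      exact this ▸ p.mono hl x h
  c_union J J' J'' p h := SetAlg.ext_val fun k x => by
    have hm : ∀ i, i ∈ J'' ↔ i ∈ J ∨ i ∈ J' := fun i => by
      rw [← Finset.mem_coe, h]; simp
    constructor
    · rintro ⟨y, hy, hp⟩
      -- The change from `x` to `y` is split in two: first on `J`, then on the rest. The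
      -- intermediate assignment is available because all finite modifications with values in the
      -- domain are admitted.
      refine ⟨⟨fun i => if i ∈ J then y.1 i else x.1 i, fun i => ?_, ?_⟩, ?_, y, ?_, hp⟩
      · dsimp only; split_ifs
        exacts [y.2.1 i, x.2.1 i]
      · exact weak_modify x.2.2 J fun i hi => by simp [hi]
      · intro i hi; simp [hi]
      · intro i hi
        by_cases hJ : i ∈ J
        · simp [hJ]
        · simp only [hJ, if_false]
          exact hy i (by simp [hm, hi, hJ])
    · rintro ⟨y, hy, z, hz, hp⟩
      refine ⟨z, fun i hi => ?_, hp⟩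
      rw [hm, not_or] at hi
      rw [hz i hi.2, hy i hi.1]
  q_union J J' J'' p h := SetAlg.ext_val fun k x => by
    have hm : ∀ i, i ∈ J'' ↔ i ∈ J ∨ i ∈ J' := fun i => by
      rw [← Finset.mem_coe, h]; simp
    constructor
    · intro hp l hl y hy l' hl' z hz
      refine hp l' (hl.trans hl') z fun i hi => ?_
      rw [hm, not_or] at hi
      rw [hz i hi.2, hy i hi.1]
    · intro hp l hl y hy
      refine hp l hl ⟨fun i => if i ∈ J then y.1 i else x.1 i, fun i => ?_, ?_⟩ ?_ l le_rfl y ?_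
      · dsimp only; split_ifs
        exacts [y.2.1 i, hD hl (x.2.1 i)]
      · exact weak_modify x.2.2 J fun i hi => by simp [hi]
      · intro i hi; simp [hi]
      · intro i hi
        by_cases hJ : i ∈ J
        · simp [hJ]
        · simp only [hJ, if_false]
          exact hy i (by simp [hm, hi, hJ])
  c_q J p := SetAlg.ext_val fun k x =>
    ⟨fun ⟨y, hy, h⟩ l hl z hz => h l hl z (hz.trans hy.symm), fun h => ⟨x, fun _ _ => rfl, h⟩⟩
  q_c J p := SetAlg.ext_val fun k x => by
    constructor
    · intro h
      exact h k le_rfl x fun _ _ => rfl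
    · rintro ⟨z, hz, h⟩ l hl y hy
      exact ⟨⟨z.1, KripkeSystem.V_mono _ hl z.2⟩, hz.trans hy.symm, p.mono hl z h⟩
  s_c σ τ J p h := SetAlg.ext_val fun k x => by
    constructor
    · rintro ⟨y, hy, hp⟩
      exact ⟨y, fun i hi => by rw [hy i hi]; simp only [h i hi], hp⟩
    · rintro ⟨y, hy, hp⟩
      exact ⟨y, fun i hi => by rw [hy i hi]; simp only [h i hi], hp⟩
  s_q σ τ J p h := SetAlg.ext_val fun k x => by
    constructor
    · intro hp l hl y hy
      exact hp l hl y fun i hi => by rw [hy i hi]; simp only [h i hi]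
    · intro hp l hl y hy
      exact hp l hl y fun i hi => by rw [hy i hi]; simp only [h i hi]
  c_s σ J J' p hJ hinj := SetAlg.ext_val fun k x => by
    have hm : ∀ i, i ∈ J' ↔ σ i ∈ J := fun i => by
      rw [← Finset.mem_coe, hJ]; simp
    constructor
    · rintro ⟨y, hy, hp⟩
      exact ⟨_, fun i hi => hy _ fun h => hi ((hm i).2 h), hp⟩
    · rintro ⟨z, hz, hp⟩
      obtain ⟨y, hy, hyz, hv⟩ := exists_extend hJ hinj hz
      refine ⟨⟨y, fun j => ?_, weak_modify x.2.2 J hy⟩, hy, ?_⟩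
      · obtain ⟨i, hi⟩ | hj := hv j
        · rw [hi]; exact z.2.1 i
        · rw [hj]; exact x.2.1 j
      · have he : (⟨fun i => y (σ i), hyz ▸ z.2⟩ :
            (weakSystem base D hD hbase).V k) = z := Subtype.ext hyz
        rw [← he] at hp
        exact hp
  q_s σ J J' p hJ hinj := SetAlg.ext_val fun k x => by
    have hm : ∀ i, i ∈ J' ↔ σ i ∈ J := fun i => by
      rw [← Finset.mem_coe, hJ]; simp
    constructor
    · intro hp l hl z hz
      obtain ⟨y, hy, hyz, hv⟩ := exists_extend hJ hinj hz
      have := hp l hl ⟨y, fun j => ?_, weak_modify x.2.2 J hy⟩ hy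
      · have he : (⟨fun i => y (σ i), hyz ▸ z.2⟩ :
            (weakSystem base D hD hbase).V l) = z := Subtype.ext hyz
        rw [← he]
        exact this
      · obtain ⟨i, hi⟩ | hj := hv j
        · rw [hi]; exact z.2.1 i
        · rw [hj]; exact hD hl (x.2.1 j)
    · intro hp l hl y hy
      exact hp l hl _ fun i hi => hy _ fun h => hi ((hm i).2 h)

end Weak

/-! ### Quantifiers and substitutions in the free algebra -/

section Algebra

variable {α : Type u} {δ : Type v} {ρ : δ → Set α}

theorem le_c (J : Finset α) (a : Fr ρ) : a ≤ c J a := ((Fr.isGPHA ρ).c_exists J).le_self a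

theorem q_le (J : Finset α) (a : Fr ρ) : q J a ≤ a := ((Fr.isGPHA ρ).q_forall J).self_le a

theorem c_mono (J : Finset α) {a b : Fr ρ} (h : a ≤ b) : c J a ≤ c J b := by
  have h1 := ((Fr.isGPHA ρ).c_exists J).map_inf a b
  have h2 : a ⊓ c J b = a := inf_eq_left.2 (h.trans (le_c J b))
  rw [h2] at h1
  exact inf_eq_left.1 h1.symm

theorem q_mono (J : Finset α) {a b : Fr ρ} (h : a ≤ b) : q J a ≤ q J b := by
  have h1 : q J (a ⇨ b) ≤ q J a ⇨ q J b := ((Fr.isGPHA ρ).q_forall J).map_himp a b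
  have h3 : (a ⇨ b) = ⊤ := himp_eq_top_iff.2 h
  have h2 : q J (⊤ : Fr ρ) = ⊤ := ((Fr.isGPHA ρ).q_forall J).map_one
  rw [h3, h2] at h1
  exact himp_eq_top_iff.1 (top_le_iff.1 h1)

theorem s_mono (σ : FinTrans α) {a b : Fr ρ} (h : a ≤ b) : s σ a ≤ s σ b := by
  have h1 : a ⊓ b = a := inf_eq_left.2 h
  have := (Fr.isGPHA ρ).s_inf σ a b
  rw [h1] at this
  exact inf_eq_left.1 this.symm

theorem q_eq_of_c_eq {J : Finset α} {a : Fr ρ} (h : c J a = a) : q J a = a := by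
  have := (Fr.isGPHA ρ).q_c J a
  rwa [h] at this

open Classical in
theorem coe_insert_eq (k : α) (J : Finset α) :
    ((insert k J : Finset α) : Set α) = ↑({k} : Finset α) ∪ ↑J := by
  rw [Finset.coe_insert, Finset.coe_singleton, Set.insert_eq]

theorem c_eq_of_forall {J : Finset α} {a : Fr ρ} (h : ∀ k ∈ J, c {k} a = a) : c J a = a := by
  classical
  induction J using Finset.induction_on with
  | empty => exact (Fr.isGPHA ρ).c_empty a
  | insert k J _ ih =>
    rw [(Fr.isGPHA ρ).c_union {k} J (insert k J) a (coe_insert_eq k J),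
      ih fun k' hk' => h k' (Finset.mem_insert_of_mem hk')]
    exact h k (Finset.mem_insert_self _ _)

/-- A substitution depends only on its values on the dimension set. -/
theorem s_congr {σ τ : FinTrans α} {a : Fr ρ} (h : ∀ i, c {i} a = a ∨ σ i = τ i) :
    s σ a = s τ a := by
  classical
  have hfin : {i | σ i ≠ τ i}.Finite := by
    refine (σ.2.union τ.2).subset fun i hi => ?_
    by_contra hn
    simp only [Set.mem_union, Set.mem_ofPred_eq, not_or, not_not] at hn
    exact hi (hn.1.trans hn.2.symm)
  -- On the finite set where `σ` and `τ` disagree `a` is already cylindrified, so the axiom `s_c`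
  -- applies to `a` itself.
  have hc : c hfin.toFinset a = a := by
    refine c_eq_of_forall fun k hk => ?_
    rw [Set.Finite.mem_toFinset] at hk
    exact (h k).resolve_right hk
  rw [← hc]
  refine (Fr.isGPHA ρ).s_c _ _ _ _ fun i hi => ?_
  by_contra hn
  exact hi (by simpa using hn)

open Classical in
/-- The finite transformation that differs from `σ` in sending `z` to `w`. -/
noncomputable def FinTrans.update (σ : FinTrans α) (z w : α) : FinTrans α :=
  ⟨Function.update σ.1 z w, (σ.2.union (Set.finite_singleton z)).subset fun i hi => by
    by_cases h : i = z
    · right; exact h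
    · left; simpa [h] using hi⟩

open Classical in
theorem FinTrans.update_apply (σ : FinTrans α) (z w i : α) :
    σ.update z w i = if i = z then w else σ i :=
  Function.update_apply σ.1 z w i

/-- Every finite set of elements has infinitely many indices outside all dimension sets. -/
def HasFresh (ρ : δ → Set α) : Prop := ∀ t : Finset (Fr ρ), {w : α | ∀ a ∈ t, c {w} a = a}.Infinite

/-- For `w` fresh, `s_σ` can be modified to a transformation pulling `w` back to `z` alone. -/
theorem exists_pullback (h : HasFresh ρ) (σ : FinTrans α) (z : α) (x b : Fr ρ) :
    ∃ (w : α) (σ' : FinTrans α), c {w} x = x ∧ s σ' b = s (σ.update z w) b ∧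
      s σ' (c {z} b) = s σ (c {z} b) ∧ s σ' (q {z} b) = s σ (q {z} b) ∧
      c {w} (s σ' b) = s σ' (c {z} b) ∧ q {w} (s σ' b) = s σ' (q {z} b) := by
  classical
  -- Besides being fresh for `x` and `b`, `w` is neither moved by `σ` nor the image of a moved
  -- index. Modifying `σ` to interchange `z` and `w` then leaves `z` as the only preimage of `w`.
  obtain ⟨w, hw, hw'⟩ := ((h {x, b}).sdiff
    ((σ.2.union (σ.2.image σ)).union (Set.finite_singleton z))).nonempty
  simp only [Finset.mem_insert, Finset.mem_singleton, forall_eq_or_imp, forall_eq,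
    Set.mem_ofPred_eq] at hw
  simp only [Set.mem_union, Set.mem_ofPred_eq, Set.mem_singleton_iff, Set.mem_image, not_or,
    not_not, not_exists, not_and] at hw'
  obtain ⟨⟨hσw, hσ⟩, hwz⟩ := hw'
  have hpre : (({z} : Finset α) : Set α) =
      ((σ.update z w).update w z) ⁻¹' ↑({w} : Finset α) := by
    ext i
    simp only [Finset.coe_singleton, Set.mem_singleton_iff, Set.mem_preimage,
      FinTrans.update_apply]
    split_ifs with h1 h2
    · subst h1; exact eq_comm
    · simp [h2]
    · simp only [h2, false_iff]
      intro h3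
      by_cases h4 : σ i = i
      · exact h1 (h4.symm.trans h3)
      · exact hσ i h4 h3
  have hpair : (({z, w} : Finset α) : Set α) = ↑({z} : Finset α) ∪ ↑({w} : Finset α) :=
    coe_insert_eq z {w}
  have hagree : ∀ i, i ∉ ({z, w} : Finset α) → (σ.update z w).update w z i = σ i := by
    intro i hi
    simp only [Finset.mem_insert, Finset.mem_singleton, not_or] at hi
    simp [FinTrans.update_apply, hi]
  have hA := Fr.isGPHA ρ
  refine ⟨w, (σ.update z w).update w z, hw.1, ?_, ?_, ?_, ?_, ?_⟩
  · refine s_congr fun i => ?_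
    by_cases hi : i = w
    · left; rw [hi]; exact hw.2
    · right; rw [FinTrans.update_apply, if_neg hi]
  -- As `w` is fresh for `b`, quantifying over `z` is quantifying over `z` and `w`, outside which
  -- the two substitutions agree.
  · have : c {z} b = c {z, w} b := by rw [hA.c_union _ _ _ b hpair, hw.2]
    rw [this]
    exact hA.s_c _ _ _ _ hagree
  · have : q {z} b = q {z, w} b := by rw [hA.q_union _ _ _ b hpair, q_eq_of_c_eq hw.2]
    rw [this]
    exact hA.s_q _ _ _ _ hagree
  · exact hA.c_s _ _ _ _ hpre (by simp)
  · exact hA.q_s _ _ _ _ hpre (by simp)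

/-- `s_σ q_z b` is the meet of the instances `s_{σ[z ↦ w]} b`. -/
theorem le_s_q_iff (h : HasFresh ρ) (σ : FinTrans α) (z : α) (x b : Fr ρ) :
    x ≤ s σ (q {z} b) ↔ ∀ w, x ≤ s (σ.update z w) b := by
  classical
  constructor
  · intro hx w
    refine hx.trans (le_trans (le_of_eq ?_) (s_mono _ (q_le {z} b)))
    refine (Fr.isGPHA ρ).s_q _ _ _ _ fun i hi => ?_
    rw [FinTrans.update_apply, if_neg (by simpa using hi)]
  · intro hx
    -- For this `w` the right side is `q_w` of a single instance, and `q_w x = x`; monotonicity of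
    -- `q_w` finishes.
    obtain ⟨w, σ', hw, h1, -, h2, -, h3⟩ := exists_pullback h σ z x b
    rw [← h2, ← h3, ← q_eq_of_c_eq hw, h1]
    exact q_mono _ (hx w)

/-- `s_σ c_z b` is the join of the instances `s_{σ[z ↦ w]} b`. -/
theorem s_c_le_iff (h : HasFresh ρ) (σ : FinTrans α) (z : α) (x b : Fr ρ) :
    s σ (c {z} b) ≤ x ↔ ∀ w, s (σ.update z w) b ≤ x := by
  classical
  constructor
  · intro hx w
    refine le_trans ((s_mono _ (le_c {z} b)).trans (le_of_eq ?_)) hx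
    refine (Fr.isGPHA ρ).s_c _ _ _ _ fun i hi => ?_
    rw [FinTrans.update_apply, if_neg (by simpa using hi)]
  · intro hx
    obtain ⟨w, σ', hw, h1, h2, -, h3, -⟩ := exists_pullback h σ z x b
    rw [← h2, ← h3, ← hw, h1]
    exact c_mono _ (hx w)

/-! ### Fresh indices -/

theorem c_comm (k : α) (J : Finset α) (a : Fr ρ) : c {k} (c J a) = c J (c {k} a) := by
  classical
  rw [← (Fr.isGPHA ρ).c_union {k} J (insert k J) a (coe_insert_eq k J),
    ← (Fr.isGPHA ρ).c_union J {k} (insert k J) a ((coe_insert_eq k J).trans (Set.union_comm _ _))]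

theorem q_comm (k : α) (J : Finset α) (a : Fr ρ) : q {k} (q J a) = q J (q {k} a) := by
  classical
  rw [← (Fr.isGPHA ρ).q_union {k} J (insert k J) a (coe_insert_eq k J),
    ← (Fr.isGPHA ρ).q_union J {k} (insert k J) a ((coe_insert_eq k J).trans (Set.union_comm _ _))]

/-- Together with `q_eq_of_c_eq`: both quantifiers have the same fixed points, so either one detects
independence of an index. -/
theorem c_eq_of_q_eq {J : Finset α} {a : Fr ρ} (h : q J a = a) : c J a = a := by
  have := (Fr.isGPHA ρ).c_q J a
  rwa [h] at this

/-- Every element depends on finitely many generators and finitely many further indices. -/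
theorem exists_support (a : Fr ρ) :
    ∃ (F : Finset δ) (J : Finset α), ∀ k, k ∉ J → (∀ i ∈ F, k ∉ ρ i) → c {k} a = a := by
  classical
  have hA := Fr.isGPHA ρ
  have binop : ∀ (f : Fr ρ → Fr ρ → Fr ρ), (∀ k x y, c ({k} : Finset α) x = x → c {k} y = y →
      c {k} (f x y) = f x y) → ∀ x y : Fr ρ,
      (∃ (F : Finset δ) (J : Finset α), ∀ k, k ∉ J → (∀ i ∈ F, k ∉ ρ i) → c {k} x = x) →
      (∃ (F : Finset δ) (J : Finset α), ∀ k, k ∉ J → (∀ i ∈ F, k ∉ ρ i) → c {k} y = y) →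
      ∃ (F : Finset δ) (J : Finset α), ∀ k, k ∉ J → (∀ i ∈ F, k ∉ ρ i) →
        c {k} (f x y) = f x y := by
    rintro f hf x y ⟨F, J, h⟩ ⟨F', J', h'⟩
    refine ⟨F ∪ F', J ∪ J', fun k hk hF => hf k x y (h k ?_ ?_) (h' k ?_ ?_)⟩
    · exact fun hn => hk (Finset.mem_union_left _ hn)
    · exact fun i hi => hF i (Finset.mem_union_left _ hi)
    · exact fun hn => hk (Finset.mem_union_right _ hn)
    · exact fun i hi => hF i (Finset.mem_union_right _ hi)
  induction Fr.mem_Sg ρ a with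
  | base x hx =>
    obtain ⟨i, rfl⟩ := hx
    exact ⟨{i}, ∅, fun k _ hk => Fr.c_gen ρ (hk i (by simp))⟩
  | bot => exact ⟨∅, ∅, fun k _ _ => (hA.c_exists {k}).map_bot⟩
  | sup x y _ _ hx hy =>
    refine binop (· ⊔ ·) (fun k x y h h' => ?_) x y hx hy
    have := (hA.c_exists {k}).map_sup x y
    rwa [h, h'] at this
  | inf x y _ _ hx hy =>
    refine binop (· ⊓ ·) (fun k x y h h' => ?_) x y hx hy
    have := (hA.c_exists {k}).map_inf x y
    rwa [h, h'] at this
  | himp x y _ _ hx hy =>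
    refine binop (· ⇨ ·) (fun k x y h h' => ?_) x y hx hy
    have := (hA.c_exists {k}).map_himp x y
    rwa [h, h'] at this
  | s τ x _ hx =>
    obtain ⟨F, J, h⟩ := hx
    -- Excluding the indices moved by `τ` and their images makes `k` its own full preimage, so `c_k`
    -- commutes with `s_τ`.
    refine ⟨F, J ∪ (τ.2.union (τ.2.image τ)).toFinset, fun k hk hF => ?_⟩
    simp only [Finset.mem_union, Set.Finite.mem_toFinset, Set.mem_union, Set.mem_ofPred_eq,
      Set.mem_image, not_or, not_not, not_exists, not_and] at hk
    have hpre : (({k} : Finset α) : Set α) = τ ⁻¹' ↑({k} : Finset α) := by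
      ext i
      simp only [Finset.coe_singleton, Set.mem_singleton_iff, Set.mem_preimage]
      constructor
      · rintro rfl; exact hk.2.1
      · intro hi
        by_contra hne
        exact hk.2.2 i (fun h' => hne (h'.symm.trans hi)) hi
    rw [hA.c_s τ {k} {k} x hpre (by simp), h k hk.1 hF]
  | c J' x _ hx =>
    obtain ⟨F, J, h⟩ := hx
    exact ⟨F, J, fun k hk hF => by rw [c_comm, h k hk hF]⟩
  | q J' x _ hx =>
    obtain ⟨F, J, h⟩ := hx
    exact ⟨F, J, fun k hk hF => c_eq_of_q_eq (by rw [q_comm, q_eq_of_c_eq (h k hk hF)])⟩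

/-- The meet of finitely many generators has the union of their dimension sets as dimension set. -/
theorem dimSet_inf_gen [Nontrivial α] (F : Finset δ) {k : α} {i : δ} (hi : i ∈ F)
    (hk : k ∈ ρ i) : k ∈ dimSet α (F.inf (Fr.gen ρ)) := by
  classical
  -- A one-world countermodel: generator `i` says that the assignment fixes every index in `ρ i`.
  -- The meet holds at the identity and fails after changing the value at `k`, so `c_k` alters it.
  let W := weakSystem (K := ULift.{u} Unit) (fun i : α => i) (fun _ => Set.univ)
    (fun _ _ _ => le_rfl) (fun _ _ => trivial)
  have hW : IsGPHA α (SetAlg W) := isGPHA_weakSystem _ _ _ _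
  let g : δ → SetAlg W := fun i => ⟨fun _ x => ∀ k ∈ ρ i, x.1 k = k, fun _ _ h => h⟩
  have hg : ∀ i k, k ∉ ρ i → c {k} (g i) = g i := by
    intro i k hk
    refine SetAlg.ext_val fun _ x => ⟨?_, fun h => ⟨x, fun _ _ => rfl, h⟩⟩
    rintro ⟨y, hy, h⟩ j hj
    rw [← hy j (by simp only [Finset.mem_singleton]; rintro rfl; exact hk hj)]
    exact h j hj
  let φ := Fr.lift hW ρ g hg
  have hφ : ∀ (G : Finset δ) (l : W.K) (x : W.V l),
      (φ.toFun (G.inf (Fr.gen ρ))).val l x ↔ ∀ i ∈ G, (g i).val l x := by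
    intro G l x
    induction G using Finset.induction_on with
    | empty =>
      have : φ.toFun ((∅ : Finset δ).inf (Fr.gen ρ)) = one := φ.map_one
      rw [this]
      simp only [Finset.notMem_empty, false_implies, implies_true, iff_true]
      exact fun _ _ h => h
    | insert j G _ ih =>
      have : φ.toFun ((insert j G).inf (Fr.gen ρ)) = g j ⊓ φ.toFun (G.inf (Fr.gen ρ)) := by
        rw [Finset.inf_insert]
        exact φ.map_inf _ _
      rw [this, Finset.forall_mem_insert, ← ih]
      exact Iff.rfl
  intro hc
  obtain ⟨k', hk'⟩ := exists_ne k
  have hx : (Function.update (fun i : α => i) k k') ∈ W.V ⟨()⟩ :=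
    ⟨fun _ => trivial, weak_modify (x := fun i : α => i) (by simp) {k}
      fun i hi => by simp only [Finset.mem_singleton] at hi; simp [hi]⟩
  have hid : (fun i : α => i) ∈ W.V ⟨()⟩ := ⟨fun _ => trivial, by simp⟩
  have hval : (φ.toFun (c {k} (F.inf (Fr.gen ρ)))).val ⟨()⟩ ⟨_, hx⟩ := by
    rw [φ.map_c]
    refine ⟨⟨_, hid⟩, ?_, (hφ _ _ _).2 fun _ _ _ _ => rfl⟩
    intro i hi
    simp only [Finset.mem_singleton] at hi
    simp [hi]
  rw [hc, hφ] at hval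
  have := hval i hi k hk
  simp only [Function.update_self] at this
  exact hk' this

/-- The dimension assumption is applied once, to the meet of all generators supporting elements of
`t`. An index outside its dimension set avoids all the relevant `ρ i`, and only finitely many
further indices have to be removed. -/
theorem hasFresh_of_dimSet [Infinite α]
    (hdim : ∀ a : Fr ρ, (dimSet α a)ᶜ.Infinite) : HasFresh ρ := by
  classical
  intro t
  choose F J hFJ using exists_support (ρ := ρ)
  refine ((hdim ((t.biUnion F).inf (Fr.gen ρ))).sdiff (t.biUnion J).finite_toSet).mono ?_
  rintro w ⟨hw, hw'⟩ a ha
  refine hFJ a w (fun h => hw' (by simpa using ⟨a, ha, h⟩)) fun i hi hρ => ?_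
  exact hw (dimSet_inf_gen _ (Finset.mem_biUnion.2 ⟨a, ha, hi⟩) hρ)

end Algebra

/-! ### Elements with parameters -/

section Dilation

variable {α : Type u} {δ : Type v} {ρ : δ → Set α} {Q : Type w}

/-- Assignments of variables or parameters from `Q` to the indices in `α`, moving only finitely
many indices. -/
def Asg (α : Type u) (Q : Type w) : Type (max u w) :=
  {f : α → α ⊕ Q // {i | f i ≠ Sum.inl i}.Finite}

namespace Asg

/-- The identical assignment. -/
def id (α : Type u) (Q : Type w) : Asg α Q := ⟨Sum.inl, by simp⟩

/-- The substitution obtained from an assignment by replacing parameters by variables. -/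
def subst (f : Asg α Q) (r : Q → α) : FinTrans α :=
  ⟨fun i => Sum.elim (fun j => j) r (f.1 i), f.2.subset fun _ hi h =>
    hi (congr_arg (Sum.elim (fun j => j) r) h)⟩

theorem subst_apply (f : Asg α Q) (r : Q → α) (i : α) :
    f.subst r i = Sum.elim (fun j => j) r (f.1 i) := rfl

/-- Precomposition with a finite transformation. -/
def comp (f : Asg α Q) (τ : FinTrans α) : Asg α Q := ⟨fun i => f.1 (τ i), finite_ne_comp f.2 τ⟩

open Classical in
/-- The assignment that differs from `f` in sending `z` to `p`. -/
noncomputable def update (f : Asg α Q) (z : α) (p : α ⊕ Q) : Asg α Q :=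
  ⟨Function.update f.1 z p, weak_modify f.2 {z} fun i hi => by
    rw [Finset.mem_singleton] at hi; simp [hi]⟩

open Classical in
theorem update_apply (f : Asg α Q) (z : α) (p : α ⊕ Q) (i : α) :
    (f.update z p).1 i = if i = z then p else f.1 i := Function.update_apply f.1 z p i

theorem update_update (f : Asg α Q) (z : α) (p p' : α ⊕ Q) :
    (f.update z p).update z p' = f.update z p' := by
  refine Subtype.ext (funext fun i => ?_)
  simp only [update_apply]
  split_ifs <;> rfl

theorem update_self (f : Asg α Q) (z : α) : f.update z (f.1 z) = f := by
  refine Subtype.ext (funext fun i => ?_)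
  rw [update_apply]
  split_ifs with h
  · rw [h]
  · rfl

/-- All parameters of `f` lie in `D`. -/
def Into (f : Asg α Q) (D : Set Q) : Prop := ∀ i d, f.1 i = Sum.inr d → d ∈ D

theorem Into.mono {f : Asg α Q} {D D' : Set Q} (h : f.Into D) (hD : D ⊆ D') : f.Into D' :=
  fun i d hd => hD (h i d hd)

theorem Into.comp {f : Asg α Q} {D : Set Q} (h : f.Into D) (τ : FinTrans α) : (f.comp τ).Into D :=
  fun i d hd => h (τ i) d hd

theorem Into.update {f : Asg α Q} {D : Set Q} (h : f.Into D) (z : α) {p : α ⊕ Q}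
    (hp : ∀ d, p = Sum.inr d → d ∈ D) : (f.update z p).Into D := by
  intro i d hd
  rw [update_apply] at hd
  split_ifs at hd
  · exact hp d hd
  · exact h i d hd

theorem id_into (D : Set Q) : (Asg.id α Q).Into D := fun _ _ h => by cases h

theorem exists_finset_into (f : Asg α Q) {D : Set Q} (h : f.Into D) :
    ∃ E : Finset Q, ↑E ⊆ D ∧ f.Into E := by
  classical
  have hfin : {d | ∃ i, f.1 i = Sum.inr d}.Finite := by
    refine Set.Finite.of_finite_image ((f.2.image f.1).subset ?_)
      (f := Sum.inr) Sum.inr_injective.injOn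
    rintro _ ⟨d, ⟨i, hi⟩, rfl⟩
    exact ⟨i, by simp [hi], hi⟩
  refine ⟨hfin.toFinset, ?_, ?_⟩
  · intro d hd
    obtain ⟨i, hi⟩ : ∃ i, f.1 i = Sum.inr d := by simpa using hd
    exact h i d hi
  · intro i d hd
    simpa using ⟨i, hd⟩

end Asg

/-- The element `a` with parameters substituted for its indices along `f`, as the family of its
instances. -/
def dil (a : Fr ρ) (f : Asg α Q) : (Q → α) → Fr ρ := fun r => s (f.subst r) a

theorem dil_bot (f : Asg α Q) : dil (⊥ : Fr ρ) f = ⊥ := funext fun _ => (Fr.isGPHA ρ).s_bot _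

theorem dil_sup (a b : Fr ρ) (f : Asg α Q) : dil (a ⊔ b) f = dil a f ⊔ dil b f :=
  funext fun _ => (Fr.isGPHA ρ).s_sup _ _ _

theorem dil_inf (a b : Fr ρ) (f : Asg α Q) : dil (a ⊓ b) f = dil a f ⊓ dil b f :=
  funext fun _ => (Fr.isGPHA ρ).s_inf _ _ _

theorem dil_himp (a b : Fr ρ) (f : Asg α Q) : dil (a ⇨ b) f = dil a f ⇨ dil b f :=
  funext fun _ => (Fr.isGPHA ρ).s_himp _ _ _

theorem dil_s (τ : FinTrans α) (a : Fr ρ) (f : Asg α Q) : dil (s τ a) f = dil a (f.comp τ) :=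
  funext fun _ => ((Fr.isGPHA ρ).s_comp _ _ _).symm

theorem dil_id (a : Fr ρ) (r : Q → α) : dil a (Asg.id α Q) r = a := (Fr.isGPHA ρ).s_one a

theorem dil_congr {a : Fr ρ} {f g : Asg α Q} (h : ∀ i, c {i} a = a ∨ f.1 i = g.1 i) :
    dil a f = dil a g :=
  funext fun r => s_congr fun i => (h i).imp_right fun hi => by
    rw [Asg.subst_apply, Asg.subst_apply, hi]

theorem subst_update (f : Asg α Q) (z : α) (p : α ⊕ Q) (r : Q → α) :
    (f.update z p).subst r = (f.subst r).update z (Sum.elim (fun j => j) r p) := by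
  refine Subtype.ext (funext fun i => ?_)
  rw [FinTrans.update_apply, Asg.subst_apply, Asg.update_apply]
  split_ifs <;> rfl

theorem dil_q_le (hfr : HasFresh ρ) (b : Fr ρ) (f : Asg α Q) (z : α) (p : α ⊕ Q) :
    dil (q {z} b) f ≤ dil b (f.update z p) := by
  intro r
  have := (le_s_q_iff hfr (f.subst r) z _ b).1 le_rfl (Sum.elim (fun j => j) r p)
  rwa [← subst_update] at this

theorem le_dil_c (hfr : HasFresh ρ) (b : Fr ρ) (f : Asg α Q) (z : α) (p : α ⊕ Q) :
    dil b (f.update z p) ≤ dil (c {z} b) f := by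
  intro r
  have := (s_c_le_iff hfr (f.subst r) z _ b).1 le_rfl (Sum.elim (fun j => j) r p)
  rwa [← subst_update] at this

open Classical in
-- When `d` occurs only at `z`, varying the instance of `d` runs through all instances of `b` at
-- `z`. This links a generic parameter with the quantifier over `z`.
theorem dil_update_update (b : Fr ρ) {f : Asg α Q} {z : α} {d : Q}
    (hf : ∀ i, i ≠ z → f.1 i ≠ Sum.inr d) (r : Q → α) (w : α) :
    dil b (f.update z (Sum.inr d)) (Function.update r d w) = s ((f.subst r).update z w) b := by
  refine congr_arg (fun σ => s σ b) (Subtype.ext (funext fun i => ?_))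
  rw [Asg.subst_apply, Asg.update_apply, FinTrans.update_apply]
  split_ifs with h
  · simp
  · rw [Asg.subst_apply]
    cases hi : f.1 i with
    | inl j => rfl
    | inr e =>
      have : e ≠ d := by rintro rfl; exact hf i h hi
      simp [this]

theorem apply_update {t : (Q → α) → Fr ρ} {d : Q} (ht : DependsOn t {d}ᶜ) [DecidableEq Q]
    (r : Q → α) (w : α) : t (Function.update r d w) = t r :=
  ht fun e he => Function.update_of_ne (by simpa using he) _ _

/-- Generalisation on a parameter: the hypothesis at `d` contains all its instances, `t` is
unaffected by them, and `s_σ q_z b` is their meet. -/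
theorem le_dil_q (hfr : HasFresh ρ) {b : Fr ρ} {f : Asg α Q} {z : α} {d : Q}
    (hf : ∀ i, i ≠ z → f.1 i ≠ Sum.inr d) {t : (Q → α) → Fr ρ} (ht : DependsOn t {d}ᶜ)
    (h : t ≤ dil b (f.update z (Sum.inr d))) : t ≤ dil (q {z} b) f := by
  classical
  intro r
  refine (le_s_q_iff hfr _ _ _ _).2 fun w => ?_
  have := h (Function.update r d w)
  rwa [dil_update_update b hf, apply_update ht] at this

theorem dil_c_le (hfr : HasFresh ρ) {b : Fr ρ} {f : Asg α Q} {z : α} {d : Q}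
    (hf : ∀ i, i ≠ z → f.1 i ≠ Sum.inr d) {t : (Q → α) → Fr ρ} (ht : DependsOn t {d}ᶜ)
    (h : dil b (f.update z (Sum.inr d)) ≤ t) : dil (c {z} b) f ≤ t := by
  classical
  intro r
  refine (s_c_le_iff hfr _ _ _ _).2 fun w => ?_
  have := h (Function.update r d w)
  rwa [dil_update_update b hf, apply_update ht] at this

/-- Finitely many elements with parameters can be written with a common assignment, in which each
parameter occurs at most once. -/
theorem exists_common (hfr : HasFresh ρ) (t : Finset (Fr ρ)) (E : Finset (α ⊕ Q)) :
    ∃ h : Asg α Q, (∀ i, h.1 i = Sum.inl i ∨ h.1 i ∈ E) ∧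
      (∀ i j d, h.1 i = Sum.inr d → h.1 j = Sum.inr d → i = j) ∧
      ∀ a ∈ t, ∀ f : Asg α Q, (∀ i, f.1 i ≠ Sum.inl i → f.1 i ∈ E) →
        ∃ τ : FinTrans α, dil a f = dil (s τ a) h := by
  classical
  have := (hfr t).to_subtype
  -- Each value in `E` receives its own fresh index, which `h` sends to that value. An assignment
  -- `f` factors through `h` by routing a moved index `i` to the fresh index of `f i`; the indices
  -- reserved in this way are irrelevant to the elements of `t`.
  obtain ⟨z, hz⟩ : ∃ z : E → {w : α | ∀ a ∈ t, c {w} a = a}, Function.Injective z :=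
    ⟨_, ((Fintype.equivFin E).toEmbedding.trans (Fin.valEmbedding.trans
      (Infinite.natEmbedding _))).injective⟩
  have hzv : Function.Injective fun e => (z e : α) := Subtype.val_injective.comp hz
  refine ⟨⟨fun i => if hi : ∃ e, (z e : α) = i then hi.choose.1 else Sum.inl i, ?_⟩, ?_, ?_, ?_⟩
  · refine (Set.finite_range fun e => (z e : α)).subset fun i hi => ?_
    by_contra hn
    refine hi ?_
    have : ¬ ∃ e, (z e : α) = i := hn
    exact dif_neg this
  · intro i
    by_cases hi : ∃ e, (z e : α) = i
    · right
      simp only [dif_pos hi]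
      exact hi.choose.2
    · left
      simp only [dif_neg hi]
  · intro i j d hi hj
    dsimp only at hi hj
    split_ifs at hi hj with h1 h2
    rw [← h1.choose_spec, ← h2.choose_spec, Subtype.ext (hi.trans hj.symm)]
  · intro a ha f hf
    refine ⟨⟨fun i => if hi : f.1 i ≠ Sum.inl i then (z ⟨f.1 i, hf i hi⟩ : α) else i, ?_⟩, ?_⟩
    · refine f.2.subset fun i hi => ?_
      by_contra hn
      refine hi ?_
      have : ¬ f.1 i ≠ Sum.inl i := hn
      exact dif_neg this
    · refine (dil_congr fun i => ?_).trans (dil_s _ _ _).symm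
      by_cases hi : f.1 i ≠ Sum.inl i
      · right
        have hex : ∃ e, (z e : α) = (z ⟨f.1 i, hf i hi⟩ : α) := ⟨_, rfl⟩
        simp only [Asg.comp, dif_pos hi, dif_pos hex]
        rw [hzv hex.choose_spec]
      · by_cases hi' : ∃ e, (z e : α) = i
        · left
          obtain ⟨e, rfl⟩ := hi'
          exact (z e).2 a ha
        · right
          simp only [Asg.comp, dif_neg hi, dif_neg hi']
          simpa using hi

/-! ### Languages with parameters and quantification over parameters -/

/-- The elements of `Sg Y` with parameters from `D`. -/
def lang (Y : Set (Fr ρ)) (D : Set Q) : Set ((Q → α) → Fr ρ) :=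
  {x | ∃ a ∈ Sg α Y, ∃ f : Asg α Q, f.Into D ∧ x = dil a f}

variable {Y Y₁ Y₂ : Set (Fr ρ)} {D D' : Set Q}

theorem dil_mem_lang {a : Fr ρ} (ha : a ∈ Sg α Y) {f : Asg α Q} (hf : f.Into D) :
    dil a f ∈ lang Y D := ⟨a, ha, f, hf, rfl⟩

theorem lang_mono (hD : D ⊆ D') : lang Y D ⊆ lang Y D' := by
  rintro _ ⟨a, ha, f, hf, rfl⟩
  exact ⟨a, ha, f, hf.mono hD, rfl⟩

theorem exists_finset_lang {x : (Q → α) → Fr ρ} (hx : x ∈ lang Y D) :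
    ∃ E : Finset Q, ↑E ⊆ D ∧ x ∈ lang Y (E : Set Q) := by
  obtain ⟨a, ha, f, hf, rfl⟩ := hx
  obtain ⟨E, hE, hf'⟩ := f.exists_finset_into hf
  exact ⟨E, hE, a, ha, f, hf', rfl⟩

/-- Turns the syntactic absence of a parameter into the independence used by the quantifier rules.
-/
theorem dependsOn_of_mem_lang {x : (Q → α) → Fr ρ} (hx : x ∈ lang Y D) : DependsOn x D := by
  obtain ⟨a, ha, f, hf, rfl⟩ := hx
  intro r r' h
  refine congr_arg (fun σ => s σ a) (Subtype.ext (funext fun i => ?_))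
  rw [Asg.subst_apply, Asg.subst_apply]
  cases hi : f.1 i with
  | inl j => rfl
  | inr d => exact h d (hf i d hi)

/-- Operations can be pulled out of `dil` only along one assignment; this is what closes `lang`
under the connectives. -/
theorem exists_common_pair (hfr : HasFresh ρ) {x y : (Q → α) → Fr ρ} (hx : x ∈ lang Y D)
    (hy : y ∈ lang Y D) : ∃ a ∈ Sg α Y, ∃ b ∈ Sg α Y, ∃ h : Asg α Q, h.Into D ∧
      x = dil a h ∧ y = dil b h := by
  classical
  obtain ⟨a, ha, f, hf, rfl⟩ := hx
  obtain ⟨b, hb, g, hg, rfl⟩ := hy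
  obtain ⟨h, h1, -, h2⟩ := exists_common hfr {a, b}
    ((f.2.image f.1).toFinset ∪ (g.2.image g.1).toFinset)
  obtain ⟨τ, hτ⟩ := h2 a (by simp) f fun i hi =>
    Finset.mem_union_left _ (by simpa using ⟨i, hi, rfl⟩)
  obtain ⟨τ', hτ'⟩ := h2 b (by simp) g fun i hi =>
    Finset.mem_union_right _ (by simpa using ⟨i, hi, rfl⟩)
  refine ⟨_, Sg.s τ a ha, _, Sg.s τ' b hb, h, fun i d hd => ?_, hτ, hτ'⟩
  rcases h1 i with hi | hi
  · rw [hi] at hd; cases hd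
  · rw [hd, Finset.mem_union, Set.Finite.mem_toFinset, Set.Finite.mem_toFinset] at hi
    obtain ⟨j, -, hj⟩ | ⟨j, -, hj⟩ := hi
    · exact hf j d hj
    · exact hg j d hj

theorem lang_bot : (⊥ : (Q → α) → Fr ρ) ∈ lang Y D :=
  ⟨⊥, Sg.bot, Asg.id α Q, Asg.id_into D, (dil_bot _).symm⟩

theorem lang_sup (hfr : HasFresh ρ) {x y : (Q → α) → Fr ρ} (hx : x ∈ lang Y D)
    (hy : y ∈ lang Y D) : x ⊔ y ∈ lang Y D := by
  obtain ⟨a, ha, b, hb, h, hh, rfl, rfl⟩ := exists_common_pair hfr hx hy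
  exact ⟨_, Sg.sup a b ha hb, h, hh, (dil_sup a b h).symm⟩

theorem lang_inf (hfr : HasFresh ρ) {x y : (Q → α) → Fr ρ} (hx : x ∈ lang Y D)
    (hy : y ∈ lang Y D) : x ⊓ y ∈ lang Y D := by
  obtain ⟨a, ha, b, hb, h, hh, rfl, rfl⟩ := exists_common_pair hfr hx hy
  exact ⟨_, Sg.inf a b ha hb, h, hh, (dil_inf a b h).symm⟩

theorem lang_himp (hfr : HasFresh ρ) {x y : (Q → α) → Fr ρ} (hx : x ∈ lang Y D)
    (hy : y ∈ lang Y D) : x ⇨ y ∈ lang Y D := by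
  obtain ⟨a, ha, b, hb, h, hh, rfl, rfl⟩ := exists_common_pair hfr hx hy
  exact ⟨_, Sg.himp a b ha hb, h, hh, (dil_himp a b h).symm⟩

/-- An assignment in which the parameter `d` occurs at most once. -/
theorem exists_single (hfr : HasFresh ρ) {d : Q} {x : (Q → α) → Fr ρ}
    (hx : x ∈ lang Y (insert d D)) : x ∈ lang Y D ∨ ∃ b ∈ Sg α Y, ∃ (f : Asg α Q) (z : α),
      f.Into D ∧ (∀ i, i ≠ z → f.1 i ≠ Sum.inr d) ∧ x = dil b (f.update z (Sum.inr d)) := by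
  classical
  obtain ⟨a, ha, f, hf, rfl⟩ := hx
  obtain ⟨h, h1, h3, h2⟩ := exists_common hfr {a} (f.2.image f.1).toFinset
  obtain ⟨τ, hτ⟩ := h2 a (by simp) f fun i hi => by simpa using ⟨i, hi, rfl⟩
  have hh : h.Into (insert d D) := by
    intro i e he
    rcases h1 i with hi | hi
    · rw [hi] at he; cases he
    · rw [he, Set.Finite.mem_toFinset] at hi
      obtain ⟨j, -, hj⟩ := hi
      exact hf j e hj
  by_cases hz : ∃ z, h.1 z = Sum.inr d
  · obtain ⟨z, hz⟩ := hz
    have hne : ∀ i, i ≠ z → h.1 i ≠ Sum.inr d := fun i hi hid => hi (h3 i z d hid hz)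
    -- Erasing `d` from its only position `z` leaves an assignment into `D`, and putting it back
    -- recovers `h`.
    refine Or.inr ⟨_, Sg.s τ a ha, h.update z (Sum.inl z), z, ?_, ?_, ?_⟩
    · intro i e he
      rw [Asg.update_apply] at he
      split_ifs at he with hi
      refine (hh i e he).resolve_left ?_
      rintro rfl
      exact hne i hi he
    · intro i hi
      rw [Asg.update_apply, if_neg hi]
      exact hne i hi
    · rw [Asg.update_update, ← hz, Asg.update_self]
      exact hτ
  · refine Or.inl ⟨_, Sg.s τ a ha, h, fun i e he => (hh i e he).resolve_left ?_, hτ⟩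
    rintro rfl
    exact hz ⟨i, he⟩

/-- After collecting `d` in a single index `z`, `q_z` quantifies over it. The result is
characterised by the order alone, without reference to `Y`. -/
theorem exists_forall_param (hfr : HasFresh ρ) {d : Q} {x : (Q → α) → Fr ρ}
    (hx : x ∈ lang Y (insert d D)) :
    ∃ y ∈ lang Y D, y ≤ x ∧ ∀ t : (Q → α) → Fr ρ, DependsOn t {d}ᶜ → t ≤ x → t ≤ y := by
  obtain hx | ⟨b, hb, f, z, hf, hne, rfl⟩ := exists_single hfr hx
  · exact ⟨x, hx, le_rfl, fun _ _ h => h⟩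
  · exact ⟨dil (q {z} b) f, dil_mem_lang (Sg.q _ b hb) hf, dil_q_le hfr _ _ _ _,
      fun t ht h => le_dil_q hfr hne ht h⟩

theorem exists_exists_param (hfr : HasFresh ρ) {d : Q} {x : (Q → α) → Fr ρ}
    (hx : x ∈ lang Y (insert d D)) :
    ∃ y ∈ lang Y D, x ≤ y ∧ ∀ t : (Q → α) → Fr ρ, DependsOn t {d}ᶜ → x ≤ t → y ≤ t := by
  obtain hx | ⟨b, hb, f, z, hf, hne, rfl⟩ := exists_single hfr hx
  · exact ⟨x, hx, le_rfl, fun _ _ h => h⟩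
  · exact ⟨dil (c {z} b) f, dil_mem_lang (Sg.c _ b hb) hf, le_dil_c hfr _ _ _ _,
      fun t ht h => dil_c_le hfr hne ht h⟩

theorem dependsOn_compl_of_mem_lang {d : Q} (hd : d ∉ D) {x : (Q → α) → Fr ρ}
    (hx : x ∈ lang Y D) : DependsOn x {d}ᶜ :=
  fun _ _ h => dependsOn_of_mem_lang hx fun e he => h e fun hed => hd (hed ▸ he)

/-- The elements with parameters from `D` common to `Sg Y₁` and `Sg Y₂`. -/
def common (Y₁ Y₂ : Set (Fr ρ)) (D : Set Q) : Set ((Q → α) → Fr ρ) := lang Y₁ D ∩ lang Y₂ D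

/-- Both languages provide a greatest lower approximation of `x` independent of `d`. Each is a
competitor for the other, so they are equal and lie in the common language. -/
theorem common_forall_param (hfr : HasFresh ρ) {d : Q} (hd : d ∉ D) {x : (Q → α) → Fr ρ}
    (hx : x ∈ common Y₁ Y₂ (insert d D)) :
    ∃ y ∈ common Y₁ Y₂ D, y ≤ x ∧ ∀ t : (Q → α) → Fr ρ, DependsOn t {d}ᶜ → t ≤ x → t ≤ y := by
  obtain ⟨y, hy, hyx, h⟩ := exists_forall_param hfr hx.1
  obtain ⟨y', hy', hyx', h'⟩ := exists_forall_param hfr hx.2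
  have : y = y' := le_antisymm (h' y (dependsOn_compl_of_mem_lang hd hy) hyx)
    (h y' (dependsOn_compl_of_mem_lang hd hy') hyx')
  subst this
  exact ⟨y, ⟨hy, hy'⟩, hyx, h⟩

theorem common_exists_param (hfr : HasFresh ρ) {d : Q} (hd : d ∉ D) {x : (Q → α) → Fr ρ}
    (hx : x ∈ common Y₁ Y₂ (insert d D)) :
    ∃ y ∈ common Y₁ Y₂ D, x ≤ y ∧ ∀ t : (Q → α) → Fr ρ, DependsOn t {d}ᶜ → x ≤ t → y ≤ t := by
  obtain ⟨y, hy, hyx, h⟩ := exists_exists_param hfr hx.1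
  obtain ⟨y', hy', hyx', h'⟩ := exists_exists_param hfr hx.2
  have : y = y' := le_antisymm (h y' (dependsOn_compl_of_mem_lang hd hy') hyx')
    (h' y (dependsOn_compl_of_mem_lang hd hy) hyx)
  subst this
  exact ⟨y, ⟨hy, hy'⟩, hyx, h⟩

theorem exists_finset_common {x : (Q → α) → Fr ρ} (hx : x ∈ common Y₁ Y₂ D) :
    ∃ E : Finset Q, ↑E ⊆ D ∧ x ∈ common Y₁ Y₂ (E : Set Q) := by
  classical
  obtain ⟨E, hE, h⟩ := exists_finset_lang hx.1
  obtain ⟨E', hE', h'⟩ := exists_finset_lang hx.2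
  refine ⟨E ∪ E', by simp [hE, hE'], lang_mono (by simp) h, lang_mono (by simp) h'⟩

theorem common_mono (hD : D ⊆ D') : common Y₁ Y₂ D ⊆ common Y₁ Y₂ D' :=
  Set.inter_subset_inter (lang_mono hD) (lang_mono hD)

/-- Universal quantification over all parameters outside `D`. -/
theorem common_forall_params (hfr : HasFresh ρ) (D : Set Q) {x : (Q → α) → Fr ρ}
    (hx : x ∈ common Y₁ Y₂ D') :
    ∃ y ∈ common Y₁ Y₂ D, y ≤ x ∧ ∀ t : (Q → α) → Fr ρ, DependsOn t D → t ≤ x → t ≤ y := by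
  classical
  obtain ⟨E, -, hE⟩ := exists_finset_common hx
  replace hE := common_mono (Set.subset_union_right (s := D)) hE
  clear hx
  induction E using Finset.induction_on generalizing x with
  | empty =>
    rw [Finset.coe_empty, Set.union_empty] at hE
    exact ⟨x, hE, le_rfl, fun _ _ h => h⟩
  | insert d E _ ih =>
    rw [Finset.coe_insert, Set.union_insert] at hE
    by_cases hd : d ∈ D ∪ (E : Set Q)
    · rw [Set.insert_eq_of_mem hd] at hE
      exact ih hE
    · obtain ⟨y, hy, hyx, h⟩ := common_forall_param hfr hd hE
      obtain ⟨y', hy', hyx', h'⟩ := ih hy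
      refine ⟨y', hy', hyx'.trans hyx, fun t ht htx => h' t ht (h t ?_ htx)⟩
      exact fun _ _ hr => ht fun e he => hr e fun hed => hd (Or.inl (hed ▸ he))

theorem common_symm : common Y₁ Y₂ D = common Y₂ Y₁ D := Set.inter_comm _ _

/-- Without parameters nothing is added. -/
theorem mem_Sg_of_common_empty [Nonempty α] {x : (Q → α) → Fr ρ}
    (hx : x ∈ common Y₁ Y₂ (∅ : Set Q)) :
    ∃ a ∈ Sg α Y₁ ∩ Sg α Y₂, x = dil a (Asg.id α Q) := by
  have key : ∀ {Y : Set (Fr ρ)}, x ∈ lang Y (∅ : Set Q) →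
      ∃ a ∈ Sg α Y, x = dil a (Asg.id α Q) := by
    rintro Y ⟨a, ha, f, hf, rfl⟩
    -- Any instance will do: no parameter occurs, so `f` already takes values in `α`.
    let r₀ : Q → α := fun _ => Classical.arbitrary α
    refine ⟨s (f.subst r₀) a, Sg.s _ a ha, ?_⟩
    rw [dil_s]
    congr 1
    refine Subtype.ext (funext fun i => ?_)
    change f.1 i = Sum.inl (f.subst r₀ i)
    rw [Asg.subst_apply]
    cases hi : f.1 i with
    | inl j => rfl
    | inr d => exact (hf i d hi).elim
  obtain ⟨a, ha, hxa⟩ := key hx.1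
  obtain ⟨b, hb, hxb⟩ := key hx.2
  have hab : a = b := by
    have := congr_fun (hxa.symm.trans hxb) fun _ => Classical.arbitrary α
    rwa [dil_id, dil_id] at this
  exact ⟨a, ⟨ha, hab ▸ hb⟩, hxa⟩

end Dilation

/-! ### Derivability -/

section Derivability

variable {B : Type w} [HeytingAlgebra B] {T T' : Set B} {x y z a b : B}

/-- `x` lies above a finite meet of elements of `T`. -/
def Der (T : Set B) (x : B) : Prop := ∃ t : Finset B, ↑t ⊆ T ∧ t.inf id ≤ x

theorem Der.of_mem (h : x ∈ T) : Der T x := ⟨{x}, by simpa using h, by simp⟩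

theorem Der.top : Der T (⊤ : B) := ⟨∅, by simp, le_top⟩

theorem Der.mono (hT : T ⊆ T') (h : Der T x) : Der T' x := by
  obtain ⟨t, ht, htx⟩ := h
  exact ⟨t, ht.trans hT, htx⟩

theorem Der.le (h : Der T x) (hxy : x ≤ y) : Der T y := by
  obtain ⟨t, ht, htx⟩ := h
  exact ⟨t, ht, htx.trans hxy⟩

theorem Der.inf (hx : Der T x) (hy : Der T y) : Der T (x ⊓ y) := by
  classical
  obtain ⟨t, ht, htx⟩ := hx
  obtain ⟨t', ht', htx'⟩ := hy
  refine ⟨t ∪ t', by simp [ht, ht'], ?_⟩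
  rw [Finset.inf_union]
  exact inf_le_inf htx htx'

theorem Der.le₂ (hx : Der T x) (hy : Der T y) (h : x ⊓ y ≤ z) : Der T z := (hx.inf hy).le h

theorem der_insert_iff : Der (insert a T) x ↔ Der T (a ⇨ x) := by
  classical
  constructor
  · rintro ⟨t, ht, htx⟩
    refine ⟨t.erase a, ?_, ?_⟩
    · intro y hy
      rw [Finset.coe_erase] at hy
      exact (ht hy.1).resolve_left hy.2
    · rw [le_himp_iff]
      refine le_trans (Finset.le_inf fun y hy => ?_) htx
      by_cases hya : y = a
      · rw [hya]; exact inf_le_right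
      · exact inf_le_left.trans (Finset.inf_le (f := id) (Finset.mem_erase.2 ⟨hya, hy⟩))
  · intro h
    refine (h.mono (Set.subset_insert a T)).le₂ (Der.of_mem (Set.mem_insert a T)) ?_
    exact himp_inf_le

theorem Der.exists_of_directed {ι : Type*} [Nonempty ι] {T : ι → Set B}
    (hT : Directed (· ⊆ ·) T) (h : Der (⋃ i, T i) x) : ∃ i, Der (T i) x := by
  obtain ⟨t, ht, htx⟩ := h
  obtain ⟨i, hi⟩ := hT.exists_mem_subset_of_finset_subset_biUnion ht
  exact ⟨i, t, hi, htx⟩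

theorem Der.exists_mem {L : Set B} (htop : ⊤ ∈ L) (hinf : ∀ x ∈ L, ∀ y ∈ L, x ⊓ y ∈ L)
    (hT : T ⊆ L) (h : Der T x) : ∃ t ∈ L, Der T t ∧ t ≤ x := by
  classical
  obtain ⟨t, ht, htx⟩ := h
  refine ⟨t.inf id, ?_, ⟨t, ht, le_rfl⟩, htx⟩
  exact Finset.inf_induction htop hinf fun y hy => hT (ht hy)

end Derivability

section Theories

variable {α : Type u} {δ : Type v} {ρ : δ → Set α} {Q : Type w}
variable {Y Y₁ Y₂ : Set (Fr ρ)} {D D' : Set Q} {F T T₁ T₂ : Set ((Q → α) → Fr ρ)}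

theorem lang_top (hfr : HasFresh ρ) : (⊤ : (Q → α) → Fr ρ) ∈ lang Y D := by
  have := lang_himp hfr (lang_bot (Y := Y) (D := D)) lang_bot
  rwa [himp_self] at this

theorem Der.exists_mem_lang (hfr : HasFresh ρ) (hT : T ⊆ lang Y D) {x : (Q → α) → Fr ρ}
    (h : Der T x) : ∃ t ∈ lang Y D, Der T t ∧ t ≤ x :=
  h.exists_mem (lang_top hfr) (fun _ hx _ hy => lang_inf hfr hx hy) hT

/-- The theory `T₂` has no consequence, in the common language with parameters from `D`, that
together with `T₁` yields an element of `F`. -/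
def Insep (Y₁ Y₂ : Set (Fr ρ)) (D : Set Q) (F T₁ T₂ : Set ((Q → α) → Fr ρ)) : Prop :=
  ∀ θ ∈ common Y₁ Y₂ D, ∀ y ∈ F, Der T₂ θ → ¬ Der T₁ (θ ⇨ y)

/-- Inseparability is preserved by adding parameters to the language. -/
theorem Insep.params (hfr : HasFresh ρ) (h : Insep Y₁ Y₂ D F T₁ T₂) (hT₂ : T₂ ⊆ lang Y₂ D)
    (D' : Set Q) : Insep Y₁ Y₂ D' F T₁ T₂ := by
  intro θ hθ y hy h₂ h₁
  obtain ⟨t, ht, hTt, htθ⟩ := h₂.exists_mem_lang hfr hT₂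
  -- `T₂` only mentions parameters in `D`, so it also yields the universal closure of `θ` over the
  -- others. Being stronger than `θ`, this closure still separates.
  obtain ⟨θ', hθ', hle, hmax⟩ := common_forall_params hfr D hθ
  exact h θ' hθ' y hy (hTt.le (hmax t (dependsOn_of_mem_lang ht) htθ))
    (h₁.le (himp_le_himp_right hle))

/-- A witness can be added to the first theory. -/
theorem Insep.witness_left (hfr : HasFresh ρ) (h : Insep Y₁ Y₂ D F T₁ T₂)
    (hT₁ : T₁ ⊆ lang Y₁ D) (hT₂ : T₂ ⊆ lang Y₂ D) (hF : F ⊆ lang Y₁ D) {d : Q} (hd : d ∉ D)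
    {b : Fr ρ} {f : Asg α Q} (hf : f.Into D) {z : α} (hb : dil (c {z} b) f ∈ T₁) :
    Insep Y₁ Y₂ (insert d D) F (insert (dil b (f.update z (Sum.inr d))) T₁) T₂ := by
  intro θ hθ y hy h₂ h₁
  obtain ⟨t, ht, hTt, htθ⟩ := h₂.exists_mem_lang hfr hT₂
  obtain ⟨θ', hθ', hle, hmax⟩ := common_forall_param hfr hd hθ
  -- The separator is `∀d θ`: `T₂` proves it since `d` is new. On the other side the witness at `d`
  -- implies `t' ⇨ (θ' ⇨ y)`, which does not mention `d`, so the existential statement already in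
  -- `T₁` implies it.
  rw [der_insert_iff] at h₁
  obtain ⟨t', ht', hTt', htθ'⟩ := h₁.exists_mem_lang hfr hT₁
  refine h θ' hθ' y hy (hTt.le (hmax t (dependsOn_compl_of_mem_lang hd ht) htθ)) ?_
  have key : dil (c {z} b) f ≤ t' ⇨ (θ' ⇨ y) := by
    refine dil_c_le hfr (fun i _ hi => hd (hf i d hi)) (dependsOn_compl_of_mem_lang hd
      (lang_himp hfr ht' (lang_himp hfr hθ'.1 (hF hy)))) ?_
    rw [le_himp_comm]
    exact htθ'.trans (himp_le_himp_left (himp_le_himp_right hle))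
  exact (Der.of_mem hb).le₂ hTt' (le_himp_iff.1 key)

/-- A witness can be added to the second theory. -/
theorem Insep.witness_right (hfr : HasFresh ρ) (h : Insep Y₁ Y₂ D F T₁ T₂)
    (hT₁ : T₁ ⊆ lang Y₁ D) (hT₂ : T₂ ⊆ lang Y₂ D) (hF : F ⊆ lang Y₁ D) {d : Q} (hd : d ∉ D)
    {b : Fr ρ} {f : Asg α Q} (hf : f.Into D) {z : α} (hb : dil (c {z} b) f ∈ T₂) :
    Insep Y₁ Y₂ (insert d D) F T₁ (insert (dil b (f.update z (Sum.inr d))) T₂) := by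
  intro θ hθ y hy h₂ h₁
  rw [der_insert_iff] at h₂
  obtain ⟨t, ht, hTt, htθ⟩ := h₂.exists_mem_lang hfr hT₂
  -- Here the separator is `∃d θ`: it follows from the existential statement in `T₂`, and it still
  -- implies `t' ⇨ y` because that element does not mention `d`.
  obtain ⟨θ', hθ', hle, hmin⟩ := common_exists_param hfr hd hθ
  obtain ⟨t', ht', hTt', htθ'⟩ := h₁.exists_mem_lang hfr hT₁
  refine h θ' hθ' y hy ?_ ?_
  · have key : dil (c {z} b) f ≤ t ⇨ θ' := by
      refine dil_c_le hfr (fun i _ hi => hd (hf i d hi)) (dependsOn_compl_of_mem_lang hd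
        (lang_himp hfr ht hθ'.2)) ?_
      rw [le_himp_comm]
      exact htθ.trans (himp_le_himp_left hle)
    exact (Der.of_mem hb).le₂ hTt (le_himp_iff.1 key)
  · refine hTt'.le ?_
    rw [le_himp_comm]
    refine hmin _ (dependsOn_compl_of_mem_lang hd (lang_himp hfr ht' (hF hy))) ?_
    rwa [le_himp_comm]

/-! ### Saturated pairs -/

/-- A pair of prime, deductively closed theories that agree on the common language. -/
structure Saturated (Y₁ Y₂ : Set (Fr ρ)) (D : Set Q) (T₁ T₂ : Set ((Q → α) → Fr ρ)) : Prop where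
  subset_left : T₁ ⊆ lang Y₁ D
  subset_right : T₂ ⊆ lang Y₂ D
  closed_left : ∀ x ∈ lang Y₁ D, Der T₁ x → x ∈ T₁
  closed_right : ∀ x ∈ lang Y₂ D, Der T₂ x → x ∈ T₂
  prime_left : ∀ x ∈ lang Y₁ D, ∀ y ∈ lang Y₁ D, x ⊔ y ∈ T₁ → x ∈ T₁ ∨ y ∈ T₁
  prime_right : ∀ x ∈ lang Y₂ D, ∀ y ∈ lang Y₂ D, x ⊔ y ∈ T₂ → x ∈ T₂ ∨ y ∈ T₂
  agree : ∀ x ∈ common Y₁ Y₂ D, x ∈ T₁ ↔ x ∈ T₂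
  bot_notMem : ⊥ ∉ T₁

theorem Saturated.symm (h : Saturated Y₁ Y₂ D T₁ T₂) : Saturated Y₂ Y₁ D T₂ T₁ where
  subset_left := h.subset_right
  subset_right := h.subset_left
  closed_left := h.closed_right
  closed_right := h.closed_left
  prime_left := h.prime_right
  prime_right := h.prime_left
  agree x hx := (h.agree x (common_symm ▸ hx)).symm
  bot_notMem hb := h.bot_notMem ((h.agree ⊥ ⟨lang_bot, lang_bot⟩).2 hb)

/-- The computation behind primality of the first theory: separators for the two disjuncts combine
to their meet, and the omitted elements to their join. -/
theorem himp_himp_sup_le {B : Type*} [HeytingAlgebra B] (x y θ θ' u u' : B) :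
    (x ⊔ y) ⊓ ((x ⇨ θ ⇨ u) ⊓ (y ⇨ θ' ⇨ u')) ≤ θ ⊓ θ' ⇨ u ⊔ u' := by
  rw [inf_sup_right]
  refine sup_le ?_ ?_
  · refine (le_trans (inf_le_inf_left x inf_le_left) inf_himp_le).trans ?_
    exact himp_le_himp inf_le_left le_sup_left
  · refine (le_trans (inf_le_inf_left y inf_le_right) inf_himp_le).trans ?_
    exact himp_le_himp inf_le_right le_sup_right

/-- An inseparable pair extends to an inseparable saturated pair. -/
theorem exists_saturated (hfr : HasFresh ρ) (hT₁ : T₁ ⊆ lang Y₁ D) (hT₂ : T₂ ⊆ lang Y₂ D)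
    (hF : F.Nonempty) (hsup : ∀ x ∈ F, ∀ y ∈ F, x ⊔ y ∈ F) (h : Insep Y₁ Y₂ D F T₁ T₂) :
    ∃ T₁' T₂', T₁ ⊆ T₁' ∧ T₂ ⊆ T₂' ∧ Saturated Y₁ Y₂ D T₁' T₂' ∧ Insep Y₁ Y₂ D F T₁' T₂' := by
  obtain ⟨⟨U₁, U₂⟩, ⟨hle₁, hle₂⟩, ⟨⟨hU₁, hU₂, hU⟩, hmax⟩⟩ := zorn_le_nonempty₀
    {p : Set ((Q → α) → Fr ρ) × Set ((Q → α) → Fr ρ) |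
      p.1 ⊆ lang Y₁ D ∧ p.2 ⊆ lang Y₂ D ∧ Insep Y₁ Y₂ D F p.1 p.2} (by
    intro C hC hchain p₀ hp₀
    have : Nonempty C := ⟨⟨p₀, hp₀⟩⟩
    have hdir : Directed (· ≤ ·) fun p : C => p.1 := hchain.directed
    have hdir₁ : Directed (· ⊆ ·) fun p : C => p.1.1 := fun p p' =>
      (hdir p p').imp fun _ h => ⟨h.1.1, h.2.1⟩
    have hdir₂ : Directed (· ⊆ ·) fun p : C => p.1.2 := fun p p' =>
      (hdir p p').imp fun _ h => ⟨h.1.2, h.2.2⟩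
    refine ⟨(⋃ p : C, p.1.1, ⋃ p : C, p.1.2), ⟨?_, ?_, ?_⟩, ?_⟩
    · exact Set.iUnion_subset fun p => (hC p.2).1
    · exact Set.iUnion_subset fun p => (hC p.2).2.1
    · intro θ hθ y hy h₂ h₁
      obtain ⟨p, hp⟩ := Der.exists_of_directed hdir₁ h₁
      obtain ⟨p', hp'⟩ := Der.exists_of_directed hdir₂ h₂
      obtain ⟨p'', h1, h2⟩ := hdir p p'
      exact (hC p''.2).2.2 θ hθ y hy (hp'.mono h2.2) (hp.mono h1.1)
    · intro p hp
      exact ⟨Set.subset_iUnion (fun p : C => p.1.1) ⟨p, hp⟩,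
        Set.subset_iUnion (fun p : C => p.1.2) ⟨p, hp⟩⟩) (T₁, T₂) ⟨hT₁, hT₂, h⟩
  dsimp only at hle₁ hle₂ hU₁ hU₂ hU
  -- By maximality, whatever is left out of a theory would create a separator when added.
  have hl : ∀ x ∈ lang Y₁ D, x ∉ U₁ →
      ∃ θ ∈ common Y₁ Y₂ D, ∃ y ∈ F, Der U₂ θ ∧ Der U₁ (x ⇨ θ ⇨ y) := by
    intro x hx hxU
    by_contra hn
    push Not at hn
    refine hxU ((hmax (y := (insert x U₁, U₂)) ⟨Set.insert_subset hx hU₁, hU₂, ?_⟩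
      ⟨Set.subset_insert _ _, le_rfl⟩).1 (Set.mem_insert _ _))
    intro θ hθ y hy h₂ h₁
    exact hn θ hθ y hy h₂ (der_insert_iff.1 h₁)
  have hr : ∀ x ∈ lang Y₂ D, x ∉ U₂ →
      ∃ θ ∈ common Y₁ Y₂ D, ∃ y ∈ F, Der U₂ (x ⇨ θ) ∧ Der U₁ (θ ⇨ y) := by
    intro x hx hxU
    by_contra hn
    push Not at hn
    refine hxU ((hmax (y := (U₁, insert x U₂)) ⟨hU₁, Set.insert_subset hx hU₂, ?_⟩
      ⟨le_rfl, Set.subset_insert _ _⟩).2 (Set.mem_insert _ _))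
    intro θ hθ y hy h₂ h₁
    exact hn θ hθ y hy (der_insert_iff.1 h₂) h₁
  have hcinf : ∀ x ∈ common Y₁ Y₂ D, ∀ y ∈ common Y₁ Y₂ D, x ⊓ y ∈ common Y₁ Y₂ D :=
    fun x hx y hy => ⟨lang_inf hfr hx.1 hy.1, lang_inf hfr hx.2 hy.2⟩
  refine ⟨U₁, U₂, hle₁, hle₂, ⟨hU₁, hU₂, ?_, ?_, ?_, ?_, ?_, ?_⟩, hU⟩
  · intro x hx hd
    by_contra hn
    obtain ⟨θ, hθ, y, hy, h₂, h₁⟩ := hl x hx hn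
    exact hU θ hθ y hy h₂ (hd.le₂ h₁ inf_himp_le)
  · intro x hx hd
    by_contra hn
    obtain ⟨θ, hθ, y, hy, h₂, h₁⟩ := hr x hx hn
    exact hU θ hθ y hy (hd.le₂ h₂ inf_himp_le) h₁
  · intro x hx y hy hxy
    by_contra hn
    push Not at hn
    obtain ⟨θ, hθ, u, hu, h₂, h₁⟩ := hl x hx hn.1
    obtain ⟨θ', hθ', u', hu', h₂', h₁'⟩ := hl y hy hn.2
    exact hU _ (hcinf θ hθ θ' hθ') _ (hsup u hu u' hu') (h₂.inf h₂')
      ((Der.of_mem hxy).le₂ (h₁.inf h₁') (himp_himp_sup_le _ _ _ _ _ _))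
  · intro x hx y hy hxy
    by_contra hn
    push Not at hn
    obtain ⟨θ, hθ, u, hu, h₂, h₁⟩ := hr x hx hn.1
    obtain ⟨θ', hθ', u', hu', h₂', h₁'⟩ := hr y hy hn.2
    -- On this side the separators combine to their join, which `U₂` proves from `x ⊔ y`.
    refine hU (θ ⊔ θ') ⟨lang_sup hfr hθ.1 hθ'.1, lang_sup hfr hθ.2 hθ'.2⟩ _ (hsup u hu u' hu')
      ((Der.of_mem hxy).le₂ (h₂.inf h₂') ?_) (h₁.le₂ h₁' ?_)
    · rw [inf_sup_right]
      exact sup_le_sup ((inf_le_inf_left x inf_le_left).trans inf_himp_le)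
        ((inf_le_inf_left y inf_le_right).trans inf_himp_le)
    · rw [sup_himp_distrib]
      exact inf_le_inf (himp_le_himp_left le_sup_left) (himp_le_himp_left le_sup_right)
  · intro x hx
    constructor
    · intro hx₁
      by_contra hn
      obtain ⟨θ, hθ, y, hy, h₂, h₁⟩ := hr x hx.2 hn
      -- `U₂` proves `x ⇨ θ`; as `x ∈ U₁`, this implies `y` over `U₁`, so it separates.
      refine hU (x ⇨ θ) ⟨lang_himp hfr hx.1 hθ.1, lang_himp hfr hx.2 hθ.2⟩ y hy h₂ ?_
      refine (Der.of_mem hx₁).le₂ h₁ ?_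
      rw [le_himp_iff, inf_right_comm]
      exact (inf_le_inf_right _ inf_himp_le).trans inf_himp_le
    · intro hx₂
      by_contra hn
      obtain ⟨θ, hθ, y, hy, h₂, h₁⟩ := hl x hx.1 hn
      -- `U₂` proves both `x` and `θ`, while `U₁` proves that together they imply `y`.
      refine hU (x ⊓ θ) (hcinf x hx θ hθ) y hy ((Der.of_mem hx₂).inf h₂) (h₁.le ?_)
      rw [himp_himp, inf_comm]
  · intro hb
    obtain ⟨y, hy⟩ := hF
    exact hU ⊤ ⟨lang_top hfr, lang_top hfr⟩ y hy Der.top ((Der.of_mem hb).le bot_le)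

end Theories

/-! ### Adding witnesses -/

section Witnesses

variable {α : Type u} {δ : Type v} {ρ : δ → Set α} {Q : Type w}
variable {Y Y₁ Y₂ : Set (Fr ρ)} {D D' : Set Q} {F T T₁ T₂ : Set ((Q → α) → Fr ρ)}

/-- Existential statements with parameters, tagged with one of two theories. -/
abbrev ExData (ρ : δ → Set α) (Q : Type w) : Type (max u v w) := Bool × Fr ρ × Asg α Q × α

/-- The theory `T` together with instances, by the parameters `ι w`, of those of its existential
statements whose tagged data `w` lie in `G`. -/
def addWitnesses (Y : Set (Fr ρ)) (D : Set Q) (T : Set ((Q → α) → Fr ρ)) (side : Bool)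
    (ι : ExData ρ Q → Q) (G : Set (ExData ρ Q)) : Set ((Q → α) → Fr ρ) :=
  T ∪ {x | ∃ b f z, (side, b, f, z) ∈ G ∧ b ∈ Sg α Y ∧ f.Into D ∧ dil (c {z} b) f ∈ T ∧
    x = dil b (f.update z (Sum.inr (ι (side, b, f, z))))}

theorem addWitnesses_subset_lang (hT : T ⊆ lang Y D) (side : Bool) (ι : ExData ρ Q → Q)
    (G : Set (ExData ρ Q)) : addWitnesses Y D T side ι G ⊆ lang Y (D ∪ ι '' G) := by
  rintro x (hx | ⟨b, f, z, hG, hb, hf, -, rfl⟩)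
  · exact lang_mono Set.subset_union_left (hT hx)
  · refine dil_mem_lang hb ((hf.mono Set.subset_union_left).update z fun d hd => ?_)
    cases hd
    exact Or.inr ⟨_, hG, rfl⟩

theorem addWitnesses_mono (side : Bool) (ι : ExData ρ Q → Q) {G G' : Set (ExData ρ Q)}
    (hG : G ⊆ G') : addWitnesses Y D T side ι G ⊆ addWitnesses Y D T side ι G' := by
  rintro x (hx | ⟨b, f, z, h, h'⟩)
  · exact Or.inl hx
  · exact Or.inr ⟨b, f, z, hG h, h'⟩

theorem Insep.anti {T₁' T₂' : Set ((Q → α) → Fr ρ)} (h : Insep Y₁ Y₂ D F T₁ T₂)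
    (h₁ : T₁' ⊆ T₁) (h₂ : T₂' ⊆ T₂) : Insep Y₁ Y₂ D F T₁' T₂' :=
  fun θ hθ y hy hd₂ hd₁ => h θ hθ y hy (hd₂.mono h₂) (hd₁.mono h₁)

theorem addWitnesses_insert_ne {side : Bool} {ι : ExData ρ Q → Q} {G : Set (ExData ρ Q)}
    {e : ExData ρ Q} (he : e.1 ≠ side) :
    addWitnesses Y D T side ι (insert e G) ⊆ addWitnesses Y D T side ι G := by
  rintro x (hx | ⟨b, f, z, h, h'⟩)
  · exact Or.inl hx
  · refine Or.inr ⟨b, f, z, h.resolve_left ?_, h'⟩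
    rintro rfl
    exact he rfl

theorem addWitnesses_insert {side : Bool} {ι : ExData ρ Q → Q} {G : Set (ExData ρ Q)}
    {b : Fr ρ} {f : Asg α Q} {z : α} :
    addWitnesses Y D T side ι (insert (side, b, f, z) G) ⊆
      insert (dil b (f.update z (Sum.inr (ι (side, b, f, z))))) (addWitnesses Y D T side ι G) := by
  rintro x (hx | ⟨b', f', z', h | h, h'⟩)
  · exact Or.inr (Or.inl hx)
  · cases h
    exact Or.inl h'.2.2.2
  · exact Or.inr (Or.inr ⟨b', f', z', h, h'⟩)

theorem addWitnesses_insert_invalid {side : Bool} {ι : ExData ρ Q → Q} {G : Set (ExData ρ Q)}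
    {b : Fr ρ} {f : Asg α Q} {z : α} (hn : ¬ (f.Into D ∧ dil (c {z} b) f ∈ T)) :
    addWitnesses Y D T side ι (insert (side, b, f, z) G) ⊆ addWitnesses Y D T side ι G := by
  rintro x (hx | ⟨b', f', z', h | h, h'⟩)
  · exact Or.inl hx
  · cases h
    exact (hn ⟨h'.2.1, h'.2.2.1⟩).elim
  · exact Or.inr ⟨b', f', z', h, h'⟩

/-- Data are added one at a time; injectivity of `ι` keeps each new parameter out of the current
language. A datum that is no existential statement of its theory adds no formula but still enlarges
the language, which `Insep.params` covers. -/
theorem Insep.addWitnesses_finset (hfr : HasFresh ρ) (h : Insep Y₁ Y₂ D F T₁ T₂)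
    (hT₁ : T₁ ⊆ lang Y₁ D) (hT₂ : T₂ ⊆ lang Y₂ D) (hF : F ⊆ lang Y₁ D) {ι : ExData ρ Q → Q}
    (hι : Function.Injective ι) (hιD : ∀ e, ι e ∉ D) (G : Finset (ExData ρ Q)) :
    Insep Y₁ Y₂ (D ∪ ι '' (G : Set (ExData ρ Q))) F (addWitnesses Y₁ D T₁ true ι G)
      (addWitnesses Y₂ D T₂ false ι G) := by
  classical
  induction G using Finset.induction_on with
  | empty =>
    have hempty : ∀ (Y : Set (Fr ρ)) (T : Set ((Q → α) → Fr ρ)) (side : Bool),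
        addWitnesses Y D T side ι ((∅ : Finset (ExData ρ Q)) : Set (ExData ρ Q)) ⊆ T := by
      rintro Y T side x (hx | ⟨b, f, z, h, -⟩)
      · exact hx
      · simp at h
    simpa using h.anti (hempty _ _ _) (hempty _ _ _)
  | insert e G he ih =>
    have h₁ := addWitnesses_subset_lang hT₁ true ι (G : Set (ExData ρ Q))
    have h₂ := addWitnesses_subset_lang hT₂ false ι (G : Set (ExData ρ Q))
    have hd : ι e ∉ D ∪ ι '' (G : Set (ExData ρ Q)) := by
      rintro (hd | ⟨e', he', hee⟩)
      · exact hιD e hd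
      · exact he (hι hee ▸ he')
    rw [Finset.coe_insert, Set.image_insert_eq, Set.union_insert]
    obtain ⟨side, b, f, z⟩ := e
    cases side
    · by_cases hv : f.Into D ∧ dil (c {z} b) f ∈ T₂
      · exact (ih.witness_right hfr h₁ h₂ (hF.trans (lang_mono Set.subset_union_left)) hd
          (hv.1.mono Set.subset_union_left) (Or.inl hv.2)).anti
          (addWitnesses_insert_ne (by simp)) addWitnesses_insert
      · exact (ih.params hfr h₂ _).anti (addWitnesses_insert_ne (by simp))
          (addWitnesses_insert_invalid hv)
    · by_cases hv : f.Into D ∧ dil (c {z} b) f ∈ T₁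
      · exact (ih.witness_left hfr h₁ h₂ (hF.trans (lang_mono Set.subset_union_left)) hd
          (hv.1.mono Set.subset_union_left) (Or.inl hv.2)).anti
          addWitnesses_insert (addWitnesses_insert_ne (by simp))
      · exact (ih.params hfr h₂ _).anti (addWitnesses_insert_invalid hv)
          (addWitnesses_insert_ne (by simp))

theorem addWitnesses_univ (side : Bool) (ι : ExData ρ Q → Q) :
    addWitnesses Y D T side ι Set.univ ⊆
      ⋃ G : Finset (ExData ρ Q), addWitnesses Y D T side ι (G : Set (ExData ρ Q)) := by
  rintro x (hx | ⟨b, f, z, -, h⟩)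
  · exact Set.mem_iUnion.2 ⟨∅, Or.inl hx⟩
  · exact Set.mem_iUnion.2 ⟨{(side, b, f, z)}, Or.inr ⟨b, f, z, by simp, h⟩⟩

/-- Witnesses for all existential statements can be added simultaneously. -/
theorem Insep.addWitnesses_univ (hfr : HasFresh ρ) (h : Insep Y₁ Y₂ D F T₁ T₂)
    (hT₁ : T₁ ⊆ lang Y₁ D) (hT₂ : T₂ ⊆ lang Y₂ D) (hF : F ⊆ lang Y₁ D) {ι : ExData ρ Q → Q}
    (hι : Function.Injective ι) (hιD : ∀ e, ι e ∉ D) (D' : Set Q) :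
    Insep Y₁ Y₂ D' F (addWitnesses Y₁ D T₁ true ι Set.univ)
      (addWitnesses Y₂ D T₂ false ι Set.univ) := by
  classical
  intro θ hθ y hy hd₂ hd₁
  have hdir : ∀ (Y : Set (Fr ρ)) (T : Set ((Q → α) → Fr ρ)) (side : Bool),
      Directed (· ⊆ ·) fun G : Finset (ExData ρ Q) =>
        addWitnesses Y D T side ι (G : Set (ExData ρ Q)) := fun Y T side G G' =>
    ⟨G ∪ G', addWitnesses_mono _ _ (by simp), addWitnesses_mono _ _ (by simp)⟩
  obtain ⟨G, hG⟩ := (hd₁.mono (PolyHeyting.addWitnesses_univ _ _)).exists_of_directed (hdir _ _ _)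
  obtain ⟨G', hG'⟩ :=
    (hd₂.mono (PolyHeyting.addWitnesses_univ _ _)).exists_of_directed (hdir _ _ _)
  -- Two derivations use only finitely many witnesses, so the finite case refutes the separator.
  refine (h.addWitnesses_finset hfr hT₁ hT₂ hF hι hιD (G ∪ G')).params hfr
    (addWitnesses_subset_lang hT₂ _ _ _) D' θ hθ y hy (hG'.mono ?_) (hG.mono ?_)
  · exact addWitnesses_mono _ _ (by simp)
  · exact addWitnesses_mono _ _ (by simp)

/-! ### Worlds -/

/-- Every existential statement of `T` has a witness among the parameters in `D`. -/
def Witnessed (Y : Set (Fr ρ)) (D : Set Q) (T : Set ((Q → α) → Fr ρ)) : Prop :=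
  ∀ b ∈ Sg α Y, ∀ f : Asg α Q, f.Into D → ∀ z, dil (c {z} b) f ∈ T →
    ∃ d ∈ D, dil b (f.update z (Sum.inr d)) ∈ T

/-- Saturated pairs of theories with witnesses. -/
structure World (Y₁ Y₂ : Set (Fr ρ)) (D : Set Q) (T₁ T₂ : Set ((Q → α) → Fr ρ)) : Prop
    extends Saturated Y₁ Y₂ D T₁ T₂ where
  witnessed_left : Witnessed Y₁ D T₁
  witnessed_right : Witnessed Y₂ D T₂

theorem World.symm (h : World Y₁ Y₂ D T₁ T₂) : World Y₂ Y₁ D T₂ T₁ :=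
  ⟨h.toSaturated.symm, h.witnessed_right, h.witnessed_left⟩

theorem Asg.Into.exists_of_iUnion {D : ℕ → Set Q} (hD : Monotone D) {f : Asg α Q}
    (hf : f.Into (⋃ n, D n)) : ∃ n, f.Into (D n) := by
  obtain ⟨E, hE, hf'⟩ := f.exists_finset_into hf
  obtain ⟨n, hn⟩ := hD.directed_le.exists_mem_subset_of_finset_subset_biUnion hE
  exact ⟨n, hf'.mono hn⟩

theorem exists_mem_lang_of_iUnion {D : ℕ → Set Q} (hD : Monotone D) {x : (Q → α) → Fr ρ}
    (hx : x ∈ lang Y (⋃ n, D n)) : ∃ n, x ∈ lang Y (D n) := by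
  obtain ⟨a, ha, f, hf, rfl⟩ := hx
  obtain ⟨n, hn⟩ := hf.exists_of_iUnion hD
  exact ⟨n, dil_mem_lang ha hn⟩

/-- The union of a sequence of saturated pairs, each with witnesses for its predecessor, is a
world. -/
theorem world_iUnion {D : ℕ → Set Q} (hD : Monotone D) {T₁ T₂ : ℕ → Set ((Q → α) → Fr ρ)}
    (hT₁ : Monotone T₁) (hT₂ : Monotone T₂) (hsat : ∀ n, Saturated Y₁ Y₂ (D n) (T₁ n) (T₂ n))
    (hw₁ : ∀ n, ∀ b ∈ Sg α Y₁, ∀ f : Asg α Q, f.Into (D n) → ∀ z, dil (c {z} b) f ∈ T₁ n →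
      ∃ d ∈ D (n + 1), dil b (f.update z (Sum.inr d)) ∈ T₁ (n + 1))
    (hw₂ : ∀ n, ∀ b ∈ Sg α Y₂, ∀ f : Asg α Q, f.Into (D n) → ∀ z, dil (c {z} b) f ∈ T₂ n →
      ∃ d ∈ D (n + 1), dil b (f.update z (Sum.inr d)) ∈ T₂ (n + 1)) :
    World Y₁ Y₂ (⋃ n, D n) (⋃ n, T₁ n) (⋃ n, T₂ n) := by
  have hsub : ∀ n, D n ⊆ ⋃ n, D n := Set.subset_iUnion D
  have closed : ∀ {Y : Set (Fr ρ)} {T : ℕ → Set ((Q → α) → Fr ρ)}, Monotone T →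
      (∀ n, ∀ x ∈ lang Y (D n), Der (T n) x → x ∈ T n) →
      ∀ x ∈ lang Y (⋃ n, D n), Der (⋃ n, T n) x → x ∈ ⋃ n, T n := by
    intro Y T hT h x hx hd
    obtain ⟨n, hn⟩ := exists_mem_lang_of_iUnion hD hx
    obtain ⟨m, hm⟩ := hd.exists_of_directed hT.directed_le
    exact Set.mem_iUnion.2 ⟨max n m, h _ x (lang_mono (hD (le_max_left n m)) hn)
      (hm.mono (hT (le_max_right n m)))⟩
  have prime : ∀ {Y : Set (Fr ρ)} {T : ℕ → Set ((Q → α) → Fr ρ)}, Monotone T →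
      (∀ n, ∀ x ∈ lang Y (D n), ∀ y ∈ lang Y (D n), x ⊔ y ∈ T n → x ∈ T n ∨ y ∈ T n) →
      ∀ x ∈ lang Y (⋃ n, D n), ∀ y ∈ lang Y (⋃ n, D n), x ⊔ y ∈ ⋃ n, T n →
        x ∈ ⋃ n, T n ∨ y ∈ ⋃ n, T n := by
    intro Y T hT h x hx y hy hxy
    obtain ⟨n, hn⟩ := exists_mem_lang_of_iUnion hD hx
    obtain ⟨m, hm⟩ := exists_mem_lang_of_iUnion hD hy
    obtain ⟨l, hl⟩ := Set.mem_iUnion.1 hxy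
    refine (h (max (max n m) l) x (lang_mono (hD (by omega)) hn) y (lang_mono (hD (by omega)) hm)
      (hT (by omega) hl)).imp ?_ ?_ <;> exact fun h => Set.mem_iUnion.2 ⟨_, h⟩
  have wit : ∀ {Y : Set (Fr ρ)} {T : ℕ → Set ((Q → α) → Fr ρ)}, Monotone T →
      (∀ n, ∀ b ∈ Sg α Y, ∀ f : Asg α Q, f.Into (D n) → ∀ z, dil (c {z} b) f ∈ T n →
        ∃ d ∈ D (n + 1), dil b (f.update z (Sum.inr d)) ∈ T (n + 1)) →
      Witnessed Y (⋃ n, D n) (⋃ n, T n) := by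
    intro Y T hT h b hb f hf z hz
    obtain ⟨n, hn⟩ := hf.exists_of_iUnion hD
    obtain ⟨m, hm⟩ := Set.mem_iUnion.1 hz
    obtain ⟨d, hd, hd'⟩ := h (max n m) b hb f (hn.mono (hD (le_max_left n m))) z
      (hT (le_max_right n m) hm)
    exact ⟨d, hsub _ hd, Set.mem_iUnion.2 ⟨_, hd'⟩⟩
  refine ⟨⟨?_, ?_, ?_, ?_, ?_, ?_, ?_, ?_⟩, wit hT₁ hw₁, wit hT₂ hw₂⟩
  · exact Set.iUnion_subset fun n => (hsat n).subset_left.trans (lang_mono (hsub n))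
  · exact Set.iUnion_subset fun n => (hsat n).subset_right.trans (lang_mono (hsub n))
  · exact closed hT₁ fun n => (hsat n).closed_left
  · exact closed hT₂ fun n => (hsat n).closed_right
  · exact prime hT₁ fun n => (hsat n).prime_left
  · exact prime hT₂ fun n => (hsat n).prime_right
  · intro x hx
    obtain ⟨n, hn⟩ := exists_mem_lang_of_iUnion hD hx.1
    obtain ⟨m, hm⟩ := exists_mem_lang_of_iUnion hD hx.2
    have key : ∀ l, x ∈ T₁ (max (max n m) l) ↔ x ∈ T₂ (max (max n m) l) := fun l =>
      (hsat _).agree x ⟨lang_mono (hD (by omega)) hn, lang_mono (hD (by omega)) hm⟩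
    simp only [Set.mem_iUnion]
    constructor
    · rintro ⟨l, hl⟩
      exact ⟨_, (key l).1 (hT₁ (le_max_right _ _) hl)⟩
    · rintro ⟨l, hl⟩
      exact ⟨_, (key l).2 (hT₂ (le_max_right _ _) hl)⟩
  · simp only [Set.mem_iUnion, not_exists]
    exact fun n => (hsat n).bot_notMem

/-- An inseparable pair extends to a world omitting `F`, provided that enough parameters are
available. -/
theorem exists_world (hfr : HasFresh ρ) {D : ℕ → Set Q} (hD : Monotone D)
    {ι : ℕ → ExData ρ Q → Q} (hι : ∀ n, Function.Injective (ι n)) (hιD : ∀ n e, ι n e ∉ D n)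
    (hιD' : ∀ n e, ι n e ∈ D (n + 1)) (hT₁ : T₁ ⊆ lang Y₁ (D 0)) (hT₂ : T₂ ⊆ lang Y₂ (D 0))
    (hFD : F ⊆ lang Y₁ (D 0)) (hF : F.Nonempty) (hsup : ∀ x ∈ F, ∀ y ∈ F, x ⊔ y ∈ F)
    (h : Insep Y₁ Y₂ (D 0) F T₁ T₂) :
    ∃ T₁' T₂', T₁ ⊆ T₁' ∧ T₂ ⊆ T₂' ∧ World Y₁ Y₂ (⋃ n, D n) T₁' T₂' ∧ ∀ y ∈ F, y ∉ T₁' := by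
  obtain ⟨U₁, U₂, hU₁, hU₂, hU⟩ := exists_saturated hfr hT₁ hT₂ hF hsup h
  have step : ∀ (n : ℕ) (p : Set ((Q → α) → Fr ρ) × Set ((Q → α) → Fr ρ)),
      Saturated Y₁ Y₂ (D n) p.1 p.2 ∧ Insep Y₁ Y₂ (D n) F p.1 p.2 →
      ∃ p' : Set ((Q → α) → Fr ρ) × Set ((Q → α) → Fr ρ),
        (Saturated Y₁ Y₂ (D (n + 1)) p'.1 p'.2 ∧ Insep Y₁ Y₂ (D (n + 1)) F p'.1 p'.2) ∧
        addWitnesses Y₁ (D n) p.1 true (ι n) Set.univ ⊆ p'.1 ∧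
        addWitnesses Y₂ (D n) p.2 false (ι n) Set.univ ⊆ p'.2 := by
    rintro n p ⟨hsat, hins⟩
    have hsub : D n ∪ ι n '' Set.univ ⊆ D (n + 1) := by
      rintro d (hd | ⟨e, -, rfl⟩)
      · exact hD n.le_succ hd
      · exact hιD' n e
    obtain ⟨V₁, V₂, h₁, h₂, hV⟩ := exists_saturated hfr
      ((addWitnesses_subset_lang hsat.subset_left true (ι n) Set.univ).trans (lang_mono hsub))
      ((addWitnesses_subset_lang hsat.subset_right false (ι n) Set.univ).trans (lang_mono hsub))
      hF hsup (hins.addWitnesses_univ hfr hsat.subset_left hsat.subset_right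
        (hFD.trans (lang_mono (hD n.zero_le))) (hι n) (hιD n) (D (n + 1)))
    exact ⟨(V₁, V₂), hV, h₁, h₂⟩
  choose! next hnext hnext₁ hnext₂ using step
  -- Each round adds witnesses for the current pair and then saturates again in the enlarged
  -- language.
  let p : ℕ → Set ((Q → α) → Fr ρ) × Set ((Q → α) → Fr ρ) := fun n => Nat.rec (U₁, U₂) next n
  have hp : ∀ n, Saturated Y₁ Y₂ (D n) (p n).1 (p n).2 ∧
      Insep Y₁ Y₂ (D n) F (p n).1 (p n).2 := by
    intro n
    induction n with
    | zero => exact hU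
    | succ n ih => exact hnext n (p n) ih
  have h₁ : ∀ n, addWitnesses Y₁ (D n) (p n).1 true (ι n) Set.univ ⊆ (p (n + 1)).1 :=
    fun n => hnext₁ n (p n) (hp n)
  have h₂ : ∀ n, addWitnesses Y₂ (D n) (p n).2 false (ι n) Set.univ ⊆ (p (n + 1)).2 :=
    fun n => hnext₂ n (p n) (hp n)
  refine ⟨⋃ n, (p n).1, ⋃ n, (p n).2, hU₁.trans (Set.subset_iUnion (fun n => (p n).1) 0),
    hU₂.trans (Set.subset_iUnion (fun n => (p n).2) 0), world_iUnion hD ?_ ?_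
    (fun n => (hp n).1) ?_ ?_, ?_⟩
  · exact monotone_nat_of_le_succ fun n => Set.subset_union_left.trans (h₁ n)
  · exact monotone_nat_of_le_succ fun n => Set.subset_union_left.trans (h₂ n)
  · intro n b hb f hf z hz
    exact ⟨_, hιD' n _, h₁ n (Or.inr ⟨b, f, z, trivial, hb, hf, hz, rfl⟩)⟩
  · intro n b hb f hf z hz
    exact ⟨_, hιD' n _, h₂ n (Or.inr ⟨b, f, z, trivial, hb, hf, hz, rfl⟩)⟩
  · intro y hy hyT
    obtain ⟨n, hn⟩ := Set.mem_iUnion.1 hyT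
    -- An element of `F` in the first theory would make `⊤` a separator.
    exact (hp n).2 ⊤ ⟨lang_top hfr, lang_top hfr⟩ y hy Der.top
      ((Der.of_mem hn).le (by rw [top_himp]))

end Witnesses

/-! ### The supply of parameters -/

section Supply

variable {α : Type u} {δ : Type v} {ρ : δ → Set α}

/-- The graph of an assignment on the indices it moves. -/
noncomputable def Asg.graph {Q : Type w} (f : Asg α Q) : Finset (α × (α ⊕ Q)) :=
  (f.2.image fun i => (i, f.1 i)).toFinset

theorem Asg.mem_graph {Q : Type w} (f : Asg α Q) (i : α) (p : α ⊕ Q) :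
    (i, p) ∈ f.graph ↔ f.1 i ≠ Sum.inl i ∧ f.1 i = p := by
  rw [Asg.graph, Set.Finite.mem_toFinset]
  constructor
  · rintro ⟨j, hj, h⟩
    cases h
    exact ⟨hj, rfl⟩
  · rintro ⟨h, rfl⟩
    exact ⟨i, h, rfl⟩

theorem Asg.graph_injective {Q : Type w} : Function.Injective (Asg.graph (α := α) (Q := Q)) := by
  intro f g h
  refine Subtype.ext (funext fun i => ?_)
  by_cases hf : f.1 i = Sum.inl i
  · by_cases hg : g.1 i = Sum.inl i
    · rw [hf, hg]
    · have := (g.mem_graph i _).2 ⟨hg, rfl⟩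
      rw [← h, Asg.mem_graph] at this
      exact this.2
  · have := (f.mem_graph i _).2 ⟨hf, rfl⟩
    rw [h, Asg.mem_graph] at this
    exact this.2.symm

/-- Parameters, each carrying a level in `ℕ × ℕ`. -/
abbrev Param (ρ : δ → Set α) : Type (max u v) := (Fr ρ × α) × ℕ × ℕ

/-- The data mention parameters themselves, so the supply must not outgrow the count. Adding levels
in `ℕ × ℕ` does not enlarge the infinite set `Fr ρ × α`, and assignments are coded by finite graphs,
so one copy of `Fr ρ × α` per level suffices. -/
theorem exists_injection_exData [Infinite α] (ρ : δ → Set α) :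
    ∃ j : ExData ρ (Param ρ) → Fr ρ × α, Function.Injective j := by
  classical
  have hA : Nonempty (Fr ρ) := ⟨⊥⟩
  let W := Fr ρ × α
  have e₁ : Fr ρ ↪ W := ⟨fun a => (a, Classical.arbitrary α), fun _ _ h => congr_arg Prod.fst h⟩
  have e₂ : α ↪ W := ⟨fun i => (⊥, i), fun _ _ h => congr_arg Prod.snd h⟩
  have e₃ : ℕ ↪ W := Infinite.natEmbedding W
  have e₄ : Bool ↪ W := ⟨fun x => e₃ x.toNat, fun x y h => by
    have := e₃.injective h
    cases x <;> cases y <;> simp_all⟩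
  have e₅ : Param ρ ↪ W × W × W :=
    (Function.Embedding.refl W).prodMap (e₃.prodMap e₃)
  have e₆ : Asg α (Param ρ) ↪ Finset (W × (W ⊕ W × W × W)) :=
    (⟨_, Asg.graph_injective⟩ : Asg α (Param ρ) ↪ _).trans
      ⟨_, Finset.map_injective (e₂.prodMap (e₂.sumMap e₅))⟩
  have e₇ : ExData ρ (Param ρ) ↪ W × W × Finset (W × (W ⊕ W × W × W)) × W :=
    e₄.prodMap (e₁.prodMap (e₆.prodMap e₂))
  have hW : Cardinal.aleph0 ≤ Cardinal.mk W := Cardinal.aleph0_le_mk W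
  have hcard : Cardinal.mk (W × W × Finset (W × (W ⊕ W × W × W)) × W) ≤ Cardinal.mk W := by
    simp only [Cardinal.mk_prod, Cardinal.lift_id, Cardinal.mk_finset_of_infinite,
      Cardinal.mk_sum, Cardinal.mul_eq_self hW, Cardinal.add_eq_self hW, le_refl]
  obtain ⟨e₈⟩ := hcard
  exact ⟨_, (e₇.trans e₈).injective⟩

/-- The parameters of level below `(m, n)` in the lexicographic order. -/
def stage (ρ : δ → Set α) (m n : ℕ) : Set (Param ρ) := {d | d.2.1 < m ∨ d.2.1 = m ∧ d.2.2 < n}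

/-- The parameters available at level `m`. -/
def level (ρ : δ → Set α) (m : ℕ) : Set (Param ρ) := {d | d.2.1 < m}

theorem level_mono : Monotone (level ρ) := fun _ _ h _ hd => lt_of_lt_of_le hd h

theorem stage_mono (m : ℕ) : Monotone (stage ρ m) := fun _ _ h _ hd =>
  hd.imp_right fun hd => ⟨hd.1, lt_of_lt_of_le hd.2 h⟩

theorem stage_zero (m : ℕ) : stage ρ m 0 = level ρ m := by
  ext d; simp [stage, level]

theorem iUnion_stage (m : ℕ) : ⋃ n, stage ρ m n = level ρ (m + 1) := by
  ext d
  simp only [Set.mem_iUnion, stage, level, Set.mem_ofPred_eq]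
  constructor
  · rintro ⟨n, h⟩
    omega
  · intro h
    exact ⟨d.2.2 + 1, by omega⟩

theorem level_zero : level ρ 0 = ∅ := by
  ext d; simp [level]

variable {Y₁ Y₂ : Set (Fr ρ)} {F T₁ T₂ : Set ((Param ρ → α) → Fr ρ)}

/-- The whole `ω`-construction stays inside level `m`: round `n` uses the parameters tagged `(m,
n)`. Everything from level `m + 1` on remains unused for later extensions. -/
theorem exists_world_level [Infinite α] (hfr : HasFresh ρ) {m : ℕ}
    (hT₁ : T₁ ⊆ lang Y₁ (level ρ m)) (hT₂ : T₂ ⊆ lang Y₂ (level ρ m))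
    (hFD : F ⊆ lang Y₁ (level ρ m)) (hF : F.Nonempty) (hsup : ∀ x ∈ F, ∀ y ∈ F, x ⊔ y ∈ F)
    (h : Insep Y₁ Y₂ (level ρ m) F T₁ T₂) :
    ∃ T₁' T₂', T₁ ⊆ T₁' ∧ T₂ ⊆ T₂' ∧ World Y₁ Y₂ (level ρ (m + 1)) T₁' T₂' ∧
      ∀ y ∈ F, y ∉ T₁' := by
  obtain ⟨j, hj⟩ := exists_injection_exData ρ
  rw [← stage_zero] at hT₁ hT₂ hFD h
  rw [← iUnion_stage]
  refine exists_world hfr (stage_mono m) (ι := fun n e => (j e, m, n))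
    (fun n e e' he => hj (congr_arg Prod.fst he)) ?_ ?_ hT₁ hT₂ hFD hF hsup h
  · intro n e he
    simp [stage] at he
  · intro n e
    simp [stage]

/-- A world refuting an implication has an extension in which the premise holds and the
conclusion fails. -/
theorem World.exists_himp [Infinite α] (hfr : HasFresh ρ) {m : ℕ}
    (h : World Y₁ Y₂ (level ρ m) T₁ T₂) {x y : (Param ρ → α) → Fr ρ}
    (hx : x ∈ lang Y₁ (level ρ m)) (hy : y ∈ lang Y₁ (level ρ m)) (hxy : x ⇨ y ∉ T₁) :
    ∃ T₁' T₂', T₁ ⊆ T₁' ∧ T₂ ⊆ T₂' ∧ World Y₁ Y₂ (level ρ (m + 1)) T₁' T₂' ∧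
      x ∈ T₁' ∧ y ∉ T₁' := by
  obtain ⟨T₁', T₂', h₁, h₂, hw, hF⟩ := exists_world_level hfr (F := {y})
    (T₁ := insert x T₁) (T₂ := T₂) (Set.insert_subset hx h.subset_left) h.subset_right
    (Set.singleton_subset_iff.2 hy) (Set.singleton_nonempty y) (by simp) (by
      rintro θ hθ _ rfl hd₂ hd₁
      rw [der_insert_iff] at hd₁
      -- A consequence of `T₂` in the common language belongs to `T₁` by agreement, so a separator
      -- would put `x ⇨ y` into `T₁`.
      have hθT : θ ∈ T₁ := (h.agree θ hθ).2 (h.closed_right θ hθ.2 hd₂)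
      refine hxy (h.closed_left _ (lang_himp hfr hx hy) ((Der.of_mem hθT).le₂ hd₁ ?_))
      rw [himp_left_comm]
      exact inf_himp_le)
  exact ⟨T₁', T₂', (Set.subset_insert _ _).trans h₁, h₂, hw, h₁ (Set.mem_insert _ _), hF y rfl⟩

/-- A world refuting a universal statement has an extension with a counterexample. -/
theorem World.exists_forall [Infinite α] (hfr : HasFresh ρ) {m : ℕ}
    (h : World Y₁ Y₂ (level ρ m) T₁ T₂) {b : Fr ρ} (hb : b ∈ Sg α Y₁) {f : Asg α (Param ρ)}
    (hf : f.Into (level ρ m)) {z : α} (hq : dil (q {z} b) f ∉ T₁) :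
    ∃ T₁' T₂', T₁ ⊆ T₁' ∧ T₂ ⊆ T₂' ∧ World Y₁ Y₂ (level ρ (m + 2)) T₁' T₂' ∧
      ∃ d ∈ level ρ (m + 2), dil b (f.update z (Sum.inr d)) ∉ T₁' := by
  -- The generic counterexample has level `m`, so it is new to `level ρ m` and available in `level ρ
  -- (m + 1)`. The new world is built from there, hence `m + 2`.
  let d : Param ρ := ((⊥, z), m, 0)
  have hd : d ∉ level ρ m := by simp [d, level]
  have hd' : d ∈ level ρ (m + 1) := by simp [d, level]
  have hle : level ρ m ⊆ level ρ (m + 1) := level_mono m.le_succ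
  obtain ⟨T₁', T₂', h₁, h₂, hw, hF⟩ := exists_world_level hfr (m := m + 1)
    (F := {dil b (f.update z (Sum.inr d))}) (T₁ := T₁) (T₂ := T₂)
    (h.subset_left.trans (lang_mono hle)) (h.subset_right.trans (lang_mono hle))
    (Set.singleton_subset_iff.2 (dil_mem_lang hb ((hf.mono hle).update z fun e he => by
      cases he; exact hd')))
    (Set.singleton_nonempty _) (by simp) (by
      -- It suffices to exclude separators without `d`. Such a separator gives a `t` derivable from
      -- `T₁`, free of `d` and below the instance at `d`, hence below the universal statement.
      refine Insep.params hfr (D := level ρ m) ?_ h.subset_right _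
      rintro θ hθ _ rfl hd₂ hd₁
      have hθT : θ ∈ T₁ := (h.agree θ hθ).2 (h.closed_right θ hθ.2 hd₂)
      obtain ⟨t, ht, hTt, htx⟩ :=
        ((Der.of_mem hθT).le₂ hd₁ inf_himp_le).exists_mem_lang hfr h.subset_left
      refine hq (h.closed_left _ (dil_mem_lang (Sg.q _ b hb) hf) (hTt.le ?_))
      exact le_dil_q hfr (fun i _ hi => hd (hf i d hi)) (dependsOn_compl_of_mem_lang hd ht) htx)
  exact ⟨T₁', T₂', h₁, h₂, hw, d, level_mono (Nat.le_succ _) hd', hF _ rfl⟩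

end Supply

/-! ### The truth lemma -/

section Truth

variable {α : Type u} [Nonempty α] {δ : Type v} {ρ : δ → Set α} {Q : Type (max u w)}
  {K : Type (max u w)} [Preorder K]

/-- The Kripke system of the finite assignments with parameters from `E k` at the world `k`. -/
abbrev paramSystem (α : Type u) [Nonempty α] (E : K → Set Q) (hE : Monotone E) :
    KripkeSystem.{u, max u w} α :=
  weakSystem (Sum.inl : α → α ⊕ Q) (fun k => {p | ∀ d, p = Sum.inr d → d ∈ E k})
    (fun _ _ h _ hp d hd => hE h (hp d hd)) (fun _ _ _ h => by cases h)

theorem isGPHA_paramSystem (E : K → Set Q) (hE : Monotone E) :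
    IsGPHA α (SetAlg (paramSystem α E hE)) := isGPHA_weakSystem _ _ _ _

variable {E : K → Set Q} {hE : Monotone E}

/-- The assignment underlying a point of the Kripke system. -/
def toAsg {k : K} (x : (paramSystem α E hE).V k) : Asg α Q := ⟨x.1, x.2.2⟩

theorem toAsg_into {k : K} (x : (paramSystem α E hE).V k) : (toAsg x).Into (E k) :=
  fun i d hd => x.2.1 i d hd

/-- The point of the Kripke system given by an assignment. -/
def ofAsg {k : K} (f : Asg α Q) (hf : f.Into (E k)) : (paramSystem α E hE).V k :=
  ⟨f.1, hf, f.2⟩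

theorem toAsg_eq_update {k l : K} {x : (paramSystem α E hE).V k} {y : (paramSystem α E hE).V l}
    {z : α} (h : EqOff {z} y.1 x.1) : toAsg y = (toAsg x).update z (y.1 z) := by
  refine Subtype.ext (funext fun i => ?_)
  rw [Asg.update_apply]
  split_ifs with hi
  · rw [hi]; rfl
  · exact h i (by simpa using hi)

theorem eqOff_update {k l : K} (x : (paramSystem α E hE).V k) (z : α) (p : α ⊕ Q)
    (hf : ((toAsg x).update z p).Into (E l)) :
    EqOff {z} (ofAsg (hE := hE) ((toAsg x).update z p) hf).1 x.1 := by
  intro i hi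
  change ((toAsg x).update z p).1 i = x.1 i
  rw [Asg.update_apply, if_neg (by simpa using hi)]
  rfl

/-- If the theories `t k` decide the elements of `Sg Y` like Kripke worlds do, then truth at a world
is membership in its theory. -/
theorem truth_lemma (hfr : HasFresh ρ) {Y : Set (Fr ρ)} {t : K → Set ((Q → α) → Fr ρ)}
    (φ : PolyHom α (Fr ρ) (SetAlg (paramSystem α E hE))) (hmono : Monotone t)
    (closed : ∀ k, ∀ x ∈ lang Y (E k), Der (t k) x → x ∈ t k)
    (prime : ∀ k, ∀ x ∈ lang Y (E k), ∀ y ∈ lang Y (E k), x ⊔ y ∈ t k → x ∈ t k ∨ y ∈ t k)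
    (hbot : ∀ k, ⊥ ∉ t k) (hwit : ∀ k, Witnessed Y (E k) (t k))
    (himp : ∀ k, ∀ x ∈ lang Y (E k), ∀ y ∈ lang Y (E k), x ⇨ y ∉ t k →
      ∃ l, k ≤ l ∧ x ∈ t l ∧ y ∉ t l)
    (hall : ∀ k, ∀ b ∈ Sg α Y, ∀ f : Asg α Q, f.Into (E k) → ∀ z, dil (q {z} b) f ∉ t k →
      ∃ l, k ≤ l ∧ ∃ d ∈ E l, dil b (f.update z (Sum.inr d)) ∉ t l)
    (hgen : ∀ a ∈ Y, ∀ k x, (φ.toFun a).val k x ↔ dil a (toAsg x) ∈ t k) :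
    ∀ a ∈ Sg α Y, ∀ k x, (φ.toFun a).val k x ↔ dil a (toAsg x) ∈ t k := by
  classical
  have mem : ∀ {a : Fr ρ}, a ∈ Sg α Y → ∀ {k} (x : (paramSystem α E hE).V k),
      dil a (toAsg x) ∈ lang Y (E k) := fun ha _ x => dil_mem_lang ha (toAsg_into x)
  have up : ∀ {k : K} {a b : Fr ρ}, b ∈ Sg α Y → ∀ (x y : (paramSystem α E hE).V k),
      dil a (toAsg x) ∈ t k → dil a (toAsg x) ≤ dil b (toAsg y) → dil b (toAsg y) ∈ t k :=
    fun hb _ y h hle => closed _ _ (mem hb y) ((Der.of_mem h).le hle)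
  have exists_single : ∀ (z : α) (a : Fr ρ), a ∈ Sg α Y →
      (∀ k x, (φ.toFun a).val k x ↔ dil a (toAsg x) ∈ t k) →
      ∀ k x, (φ.toFun (c {z} a)).val k x ↔ dil (c {z} a) (toAsg x) ∈ t k := by
    intro z a ha ih k x
    rw [φ.map_c]
    constructor
    · rintro ⟨y, hy, h⟩
      refine up (Sg.c _ a ha) y x ((ih k y).1 h) ?_
      rw [toAsg_eq_update hy]
      exact le_dil_c hfr _ _ _ _
    · intro h
      obtain ⟨d, hd, hdT⟩ := hwit k a ha (toAsg x) (toAsg_into x) z h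
      have hf : ((toAsg x).update z (Sum.inr d)).Into (E k) :=
        (toAsg_into x).update z fun e he => by cases he; exact hd
      exact ⟨ofAsg _ hf, eqOff_update x z _ hf, (ih k _).2 hdT⟩
  have forall_single : ∀ (z : α) (a : Fr ρ), a ∈ Sg α Y →
      (∀ k x, (φ.toFun a).val k x ↔ dil a (toAsg x) ∈ t k) →
      ∀ k x, (φ.toFun (q {z} a)).val k x ↔ dil (q {z} a) (toAsg x) ∈ t k := by
    intro z a ha ih k x
    rw [φ.map_q]
    constructor
    · intro h
      by_contra hn
      obtain ⟨l, hl, d, hd, hdT⟩ := hall k a ha (toAsg x) (toAsg_into x) z hn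
      have hf : ((toAsg x).update z (Sum.inr d)).Into (E l) :=
        ((toAsg_into x).mono (hE hl)).update z fun e he => by cases he; exact hd
      exact hdT ((ih l _).1 (h l hl (ofAsg _ hf) (eqOff_update x z _ hf)))
    · intro h l hl y hy
      refine (ih l y).2 (closed _ _ (mem ha y) ((Der.of_mem (hmono hl h)).le ?_))
      rw [toAsg_eq_update hy]
      exact dil_q_le hfr _ _ _ _
  intro a ha
  induction ha with
  | base a ha => exact hgen a ha
  | bot =>
    intro k x
    rw [φ.map_bot]
    refine ⟨False.elim, fun h => hbot k ?_⟩
    rwa [dil_bot] at h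
  | sup a b ha hb iha ihb =>
    intro k x
    rw [φ.map_sup]
    refine (or_congr (iha k x) (ihb k x)).trans ⟨?_, fun h => ?_⟩
    · rintro (h | h)
      · exact up (Sg.sup a b ha hb) x x h ((dil_sup a b (toAsg x)).symm ▸ le_sup_left)
      · exact up (Sg.sup a b ha hb) x x h ((dil_sup a b (toAsg x)).symm ▸ le_sup_right)
    · rw [dil_sup] at h
      exact prime k _ (mem ha x) _ (mem hb x) h
  | inf a b ha hb iha ihb =>
    intro k x
    rw [φ.map_inf]
    refine (and_congr (iha k x) (ihb k x)).trans ⟨fun h => ?_, fun h => ⟨?_, ?_⟩⟩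
    · refine closed k _ (mem (Sg.inf a b ha hb) x) ?_
      rw [dil_inf]
      exact (Der.of_mem h.1).inf (Der.of_mem h.2)
    · exact up ha x x h ((dil_inf a b (toAsg x)).symm ▸ inf_le_left)
    · exact up hb x x h ((dil_inf a b (toAsg x)).symm ▸ inf_le_right)
  | himp a b ha hb iha ihb =>
    intro k x
    rw [φ.map_himp, dil_himp]
    constructor
    · intro h
      by_contra hn
      obtain ⟨l, hl, hx, hy⟩ := himp k _ (mem ha x) _ (mem hb x) hn
      exact hy ((ihb l _).1 (h l hl ((iha l _).2 hx)))
    · intro h l hl hx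
      refine (ihb l _).2 (closed l _ (mem hb _) ?_)
      exact (Der.of_mem ((iha l _).1 hx)).le₂ (Der.of_mem (hmono hl h)) inf_himp_le
  | s τ a ha ih =>
    intro k x
    rw [φ.map_s, dil_s]
    exact ih k _
  | c J a ha ih =>
    -- A finite block of quantifiers is peeled off one index at a time, since witnesses and
    -- counterexamples are provided for single indices.
    induction J using Finset.induction_on with
    | empty => rwa [(Fr.isGPHA ρ).c_empty]
    | insert z J _ ihJ =>
      rw [(Fr.isGPHA ρ).c_union {z} J (insert z J) a (coe_insert_eq z J)]
      exact exists_single z _ (Sg.c J a ha) ihJ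
  | q J a ha ih =>
    induction J using Finset.induction_on with
    | empty => rwa [(Fr.isGPHA ρ).q_empty]
    | insert z J _ ihJ =>
      rw [(Fr.isGPHA ρ).q_union {z} J (insert z J) a (coe_insert_eq z J)]
      exact forall_single z _ (Sg.q J a ha) ihJ

end Truth

/-! ### The canonical model -/

section Canonical

variable {α : Type u} {δ : Type v} {ρ : δ → Set α} (X₁ X₂ : Set (Fr ρ))

/-- The worlds of the canonical model, with their levels. -/
abbrev CanonicalWorld : Type (max u v) :=
  {k : ℕ × Set ((Param ρ → α) → Fr ρ) × Set ((Param ρ → α) → Fr ρ) //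
    World X₁ X₂ (level ρ k.1) k.2.1 k.2.2}

theorem canonical_level_mono :
    Monotone fun k : CanonicalWorld X₁ X₂ => level ρ k.1.1 := fun _ _ h => level_mono h.1

variable [Infinite α]

/-- The canonical Kripke system. -/
abbrev canonicalSystem : KripkeSystem.{u, max u v} α :=
  paramSystem.{u, v} α (fun k : CanonicalWorld X₁ X₂ => level ρ k.1.1)
    (canonical_level_mono X₁ X₂)

/-- The value of a generator in the canonical model. -/
def canonicalGen (i : δ) : SetAlg (canonicalSystem X₁ X₂) where
  val k x := dil (Fr.gen ρ i) (toAsg x) ∈ k.1.2.1 ∪ k.1.2.2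
  mono h _ := Or.imp (fun hx => h.2.1 hx) (fun hx => h.2.2 hx)

/-- Instances of a generator along assignments differing only at an index outside `ρ i` are the same
element; this is the condition required by `Fr.lift`. -/
theorem c_canonicalGen (i : δ) (k : α) (hk : k ∉ ρ i) :
    c {k} (canonicalGen X₁ X₂ i) = canonicalGen X₁ X₂ i := by
  refine SetAlg.ext_val fun l x => ⟨?_, fun h => ⟨x, fun _ _ => rfl, h⟩⟩
  rintro ⟨y, hy, h⟩
  have : dil (Fr.gen ρ i) (toAsg y) = dil (Fr.gen ρ i) (toAsg x) := by
    refine dil_congr fun j => ?_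
    by_cases hj : j = k
    · left; rw [hj]; exact Fr.c_gen ρ hk
    · right; exact hy j (by simpa using hj)
  change dil (Fr.gen ρ i) (toAsg x) ∈ _
  rw [← this]
  exact h

/-- The homomorphism onto the canonical model. -/
noncomputable def canonicalHom : PolyHom α (Fr ρ) (SetAlg (canonicalSystem X₁ X₂)) :=
  Fr.lift (isGPHA_paramSystem _ _) ρ (canonicalGen X₁ X₂) (c_canonicalGen X₁ X₂)

variable {X₁ X₂}

/-- For a generator in `X₁`, membership of an instance in the second theory puts it in the common
language, where agreement carries it to the first. The accessible worlds demanded by `truth_lemma`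
are the extensions of `World.exists_himp` and `World.exists_forall`. -/
theorem canonical_truth_left (hfr : HasFresh ρ) (hX : X₁ ⊆ Set.range (Fr.gen ρ)) :
    ∀ a ∈ Sg α X₁, ∀ (k : CanonicalWorld X₁ X₂) (x : (canonicalSystem X₁ X₂).V k),
      ((canonicalHom X₁ X₂).toFun a).val k x ↔ dil a (toAsg x) ∈ k.1.2.1 := by
  refine truth_lemma hfr (canonicalHom X₁ X₂) (t := fun k => k.1.2.1) (fun _ _ h => h.2.1)
    (fun k => k.2.closed_left) (fun k => k.2.prime_left) (fun k => k.2.bot_notMem)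
    (fun k => k.2.witnessed_left) ?_ ?_ ?_
  · intro k x hx y hy hxy
    obtain ⟨T₁', T₂', h₁, h₂, hw, h⟩ := k.2.exists_himp hfr hx hy hxy
    exact ⟨⟨(k.1.1 + 1, T₁', T₂'), hw⟩, ⟨Nat.le_succ _, h₁, h₂⟩, h⟩
  · intro k b hb f hf z hz
    obtain ⟨T₁', T₂', h₁, h₂, hw, h⟩ := k.2.exists_forall hfr hb hf hz
    exact ⟨⟨(k.1.1 + 2, T₁', T₂'), hw⟩, ⟨Nat.le_add_right _ _, h₁, h₂⟩, h⟩
  · intro a ha k x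
    obtain ⟨i, rfl⟩ := hX ha
    refine ⟨fun h => ?_, Or.inl⟩
    obtain h | h : _ ∨ _ := h
    · exact h
    · exact (k.2.agree _ ⟨dil_mem_lang (Sg.base _ ha) (toAsg_into x), k.2.subset_right h⟩).2 h

theorem canonical_truth_right (hfr : HasFresh ρ) (hX : X₂ ⊆ Set.range (Fr.gen ρ)) :
    ∀ a ∈ Sg α X₂, ∀ (k : CanonicalWorld X₁ X₂) (x : (canonicalSystem X₁ X₂).V k),
      ((canonicalHom X₁ X₂).toFun a).val k x ↔ dil a (toAsg x) ∈ k.1.2.2 := by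
  refine truth_lemma hfr (canonicalHom X₁ X₂) (t := fun k => k.1.2.2) (fun _ _ h => h.2.2)
    (fun k => k.2.closed_right) (fun k => k.2.prime_right) (fun k => k.2.symm.bot_notMem)
    (fun k => k.2.witnessed_right) ?_ ?_ ?_
  · intro k x hx y hy hxy
    obtain ⟨T₂', T₁', h₂, h₁, hw, h⟩ := k.2.symm.exists_himp hfr hx hy hxy
    exact ⟨⟨(k.1.1 + 1, T₁', T₂'), hw.symm⟩, ⟨Nat.le_succ _, h₁, h₂⟩, h⟩
  · intro k b hb f hf z hz
    obtain ⟨T₂', T₁', h₂, h₁, hw, h⟩ := k.2.symm.exists_forall hfr hb hf hz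
    exact ⟨⟨(k.1.1 + 2, T₁', T₂'), hw.symm⟩, ⟨Nat.le_add_right _ _, h₁, h₂⟩, h⟩
  · intro a ha k x
    obtain ⟨i, rfl⟩ := hX ha
    refine ⟨fun h => ?_, Or.inr⟩
    obtain h | h : _ ∨ _ := h
    · exact (k.2.agree _ ⟨k.2.subset_left h, dil_mem_lang (Sg.base _ ha) (toAsg_into x)⟩).1 h
    · exact h

end Canonical

/-! ### The initial pair of theories -/

section Initial

variable {α : Type u} {δ : Type v} {ρ : δ → Set α}

theorem listMeet_le {l : List (Fr ρ)} {a : Fr ρ} (ha : a ∈ l) : listMeet l ≤ a := by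
  induction l with
  | nil => simp at ha
  | cons b l ih =>
    rcases List.mem_cons.1 ha with rfl | h
    · exact inf_le_left (a := a) (b := listMeet l)
    · exact (inf_le_right (a := b) (b := listMeet l)).trans (ih h)

theorem listJoin_append (l m : List (Fr ρ)) : listJoin (l ++ m) = listJoin l ⊔ listJoin m := by
  induction l with
  | nil => exact (bot_sup_eq (listJoin m)).symm
  | cons b l ih =>
    have h : listJoin (b :: (l ++ m)) = b ⊔ listJoin (l ++ m) := rfl
    have h' : listJoin (b :: l) = b ⊔ listJoin l := rfl
    rw [List.cons_append, h, h', ih]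
    exact (sup_assoc b (listJoin l) (listJoin m)).symm

theorem listJoin_singleton (a : Fr ρ) : listJoin [a] = a := sup_bot_eq a

theorem Sg_listJoin {Y : Set (Fr ρ)} {l : List (Fr ρ)} (hl : ∀ a ∈ l, a ∈ Sg α Y) :
    listJoin l ∈ Sg α Y := by
  induction l with
  | nil => exact Sg.bot
  | cons b l ih =>
    exact Sg.sup b _ (hl b (by simp)) (ih fun a ha => hl a (List.mem_cons_of_mem _ ha))

/-- Evaluating at one constant instance turns parameter-free families back into the original
elements. -/
theorem exists_list_of_der [Nonempty α] {Q : Type w} {S : Set (Fr ρ)} {a : Fr ρ}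
    (h : Der ((fun b => dil b (Asg.id α Q)) '' S) (dil a (Asg.id α Q))) :
    ∃ l : List (Fr ρ), (∀ b ∈ l, b ∈ S) ∧ listMeet l ≤ a := by
  obtain ⟨t, ht, hta⟩ := h
  let r : Q → α := fun _ => Classical.arbitrary α
  refine ⟨t.toList.map fun x => x r, ?_, ?_⟩
  · intro b hb
    obtain ⟨x, hx, rfl⟩ := List.mem_map.1 hb
    obtain ⟨b', hb', rfl⟩ := ht (Finset.mem_toList.1 hx)
    change dil b' (Asg.id α Q) r ∈ S
    rwa [dil_id]
  · have := hta r
    rw [dil_id, Finset.inf_apply] at this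
    exact (Finset.le_inf fun x hx =>
      listMeet_le (List.mem_map.2 ⟨x, Finset.mem_toList.2 hx, rfl⟩)).trans this

end Initial

end PolyHeyting

/-! ### The joint model -/

open PolyHeyting in
theorem mainTheorem1 {α : Type u} [Infinite α] {δ : Type v} [Nonempty δ] (ρ : δ → Set α)
    (hρ : ∀ i, (ρ i)ᶜ.Infinite)
    (hdim : ∀ a : PolyHeyting.Fr ρ, (PolyHeyting.dimSet α a)ᶜ.Infinite)
    (X₁ X₂ : Set (PolyHeyting.Fr ρ))
    (hX : X₁ ∪ X₂ = Set.range (PolyHeyting.Fr.gen ρ))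
    (Δ₀ Γ₀ Θ₀ Γ₀' : Set (PolyHeyting.Fr ρ))
    (hth₁ : PolyHeyting.IsTheoryIn (PolyHeyting.Sg α X₁) Δ₀ Γ₀)
    (hth₂ : PolyHeyting.IsTheoryIn (PolyHeyting.Sg α X₂) Θ₀ Γ₀')
    (hcons₁ : PolyHeyting.Consistent Δ₀ Γ₀)
    (hcons₂ : PolyHeyting.Consistent Θ₀ Γ₀')
    (hΓ : Γ₀ ⊆ PolyHeyting.Sg α (X₁ ∩ X₂))
    (hΓΓ' : Γ₀ ⊆ Γ₀')
    (hcomplete : PolyHeyting.CompleteIn (PolyHeyting.Sg α X₁ ∩ PolyHeyting.Sg α X₂)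
      (Δ₀ ∩ Θ₀ ∩ PolyHeyting.Sg α X₁ ∩ PolyHeyting.Sg α X₂) Γ₀) :
    ∃ (S : PolyHeyting.KripkeSystem.{u, max u v} α)
      (ψ : PolyHeyting.PolyHom α (PolyHeyting.Fr ρ) (PolyHeyting.SetAlg S))
      (k₀ : S.K) (x : S.V k₀),
      (∀ p ∈ Δ₀ ∪ Θ₀, (ψ.toFun p).val k₀ x) ∧ ∀ p ∈ Γ₀', ¬ (ψ.toFun p).val k₀ x := by
  have hfr : HasFresh ρ := hasFresh_of_dimSet hdim
  let emb : Fr ρ → (Param ρ → α) → Fr ρ := fun b => dil b (Asg.id α (Param ρ))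
  have hemb : ∀ {Y S : Set (Fr ρ)}, S ⊆ Sg α Y → emb '' S ⊆ lang Y (level ρ 0) := by
    rintro Y S hS _ ⟨a, ha, rfl⟩
    exact dil_mem_lang (hS ha) (Asg.id_into _)
  -- `exists_world_level` omits a nonempty set closed under joins, so `Γ₀'` is replaced by its
  -- finite joins; the empty join `⊥` gives nonemptiness.
  let F := emb '' {a | ∃ l : List (Fr ρ), (∀ b ∈ l, b ∈ Γ₀') ∧ a = listJoin l}
  -- The omitted elements must belong to the first language, so `X₂` and `Θ₀` play the first role
  -- here, and the resulting world is reversed afterwards.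
  obtain ⟨T₂, T₁, h₂, h₁, hw, hF⟩ := exists_world_level hfr (F := F) (hemb hth₂.1) (hemb hth₁.1)
    (hemb (by
      rintro _ ⟨l, hl, rfl⟩
      exact Sg_listJoin fun a ha => hth₂.2 (hl a ha)))
    ⟨_, ⊥, ⟨[], by simp, rfl⟩, rfl⟩ (by
      rintro _ ⟨_, ⟨l, hl, rfl⟩, rfl⟩ _ ⟨_, ⟨m, hm, rfl⟩, rfl⟩
      refine ⟨_, ⟨l ++ m, ?_, rfl⟩, ?_⟩
      · intro b hb
        exact (List.mem_append.1 hb).elim (hl b) (hm b)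
      · change dil _ _ = dil _ _ ⊔ dil _ _
        rw [listJoin_append]
        exact dil_sup _ _ _) (by
      rintro θ hθ _ ⟨_, ⟨m, hm, rfl⟩, rfl⟩ hd₁ hd₂
      rw [level_zero] at hθ
      obtain ⟨a, ha, rfl⟩ := mem_Sg_of_common_empty hθ
      obtain ⟨l, hl, hla⟩ := exists_list_of_der hd₁
      -- The separator `a` follows from `Δ₀`, and `a ⇨ listJoin m` follows from `Θ₀`. If `a ∈ Θ₀`,
      -- then `Θ₀` proves a join of elements of `Γ₀'`; if `a ∈ Γ₀`, then `Δ₀` proves an element of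
      -- `Γ₀`.
      rcases hcomplete a ⟨ha.2, ha.1⟩ with h | h
      · have hd : Der (emb '' Θ₀) (dil (a ⇨ listJoin m) (Asg.id α (Param ρ))) :=
          hd₂.le (dil_himp _ _ _).ge
        obtain ⟨l', hl', hla'⟩ := exists_list_of_der hd
        refine hcons₂ ⟨a :: l', m, ?_, hm, ?_⟩
        · exact List.forall_mem_cons.2 ⟨h.1.1.2, hl'⟩
        · have : a ⊓ listMeet l' ≤ listJoin m := (inf_le_inf_left a hla').trans inf_himp_le
          exact this
      · refine hcons₁ ⟨l, [a], hl, by simpa using h, ?_⟩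
        rw [listJoin_singleton]
        exact hla)
  have hX₁ : X₁ ⊆ Set.range (Fr.gen ρ) := hX ▸ Set.subset_union_left
  have hX₂ : X₂ ⊆ Set.range (Fr.gen ρ) := hX ▸ Set.subset_union_right
  let k₀ : CanonicalWorld X₁ X₂ := ⟨(1, T₁, T₂), hw.symm⟩
  refine ⟨canonicalSystem X₁ X₂, canonicalHom X₁ X₂, k₀,
    ofAsg (Asg.id α (Param ρ)) (Asg.id_into _), ?_, ?_⟩
  · rintro p (hp | hp)
    · exact (canonical_truth_left hfr hX₁ p (hth₁.1 hp) k₀ _).2 (h₁ ⟨p, hp, rfl⟩)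
    · exact (canonical_truth_right hfr hX₂ p (hth₂.1 hp) k₀ _).2 (h₂ ⟨p, hp, rfl⟩)
  · intro p hp h
    refine hF (emb p) ⟨p, ⟨[p], by simpa using hp, (listJoin_singleton p).symm⟩, rfl⟩ ?_
    exact (canonical_truth_right hfr hX₂ p (hth₂.2 hp) k₀ _).1 h
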